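/- Let $\phi(z)=\sum_{n\ge 1}\phi_n z^n$ be a formal power series with real coefficients (so $\phi(0)=0$) and put $f(z)=z\bigl(1-\phi(z)\bigr)=\sum_{n\ge1}f_nz^n$. For $0<q<1$ let $g(z)=\sum_{n\ge 1}g_n z^n$ (with $g_n=g_n(q)$) be the formal power series without constant term that satisfies $$\sum_{n\ge 1} f_n\, g(z)g(z/q)\cdots g(z/q^{n-1})=z .$$ Write $\tilde\phi(z)=\phi(-z)$ and $\tilde\phi_n=(-1)^n\phi_n$. **(A)** Assume that (i) $\tilde\phi_i\ge 0$ for all $i\ge 1$; (ii) $\zeta=\min\{x>0:\tilde\phi(x)=1\}$ exists; (iii) for every integer $j\ge 0$, $\lim_{n\to\infty}\tilde\phi_{j+n}/\tilde\phi_n$ exists in $[0,\infty)$ (quotients with $\tilde\phi_n=0$ being read as $0$); (iv) the sequence $c_n=[z^n]\frac{1}{1-\tilde\phi(\zeta z)}$ is regularly varying with index $\rho-1\in(-1,0]$, that is, $\lim_{t\to\infty}c_{\lfloor\lambda t\rfloor}/c_{\lfloor t\rfloor}=\lambda^{\rho-1}$ for every $\lambda>0$. For $n\ge 1$ and $0<q<1$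 put $$a_n(q)=\zeta^n n\Bigl(1-\tilde\phi\bigl(\zeta(1-\tfrac1n)\bigr)\Bigr)q^{\binom n2}(-1)^{n+1}g_n,\qquad L(q)=\frac{\zeta}{\Gamma(\rho)\prod_{j\ge 1}\bigl(1-\tilde\phi(\zeta q^j)\bigr)} .$$ Then each $a_n$ is a polynomial in $q$, the product converges and $L$ is given on $(0,1)$ by a convergent power series in $q$, and $a_n\to L$ in the following three senses: $\liminf_{n\to\infty}a_n(q)=L(q)$ for every $q\in(0,1)$; for every $q\in(0,1)$ and $\delta>0$, $\lim_{n\to\infty}\frac1n\#\{1\le i\le n:|a_i(q)-L(q)|\ge\delta\}=0$; and $\lim_{n\to\infty}[q^j]a_n=[q^j]L$ for every integer $j\ge0$. **(B)** Assume that $\tilde\phi_n\ge0$ for all $n$, that $\limsup_{n\to\infty}\frac{\log\tilde\phi_n}{n\log n}<-2$ (with $\log 0=-\infty$), and that $\tilde\phi(z)=1-(1-z/\zeta)\theta(z)$ for all $z\in\mathbb C$ (in particular $\tilde\phi(\zeta)=1$), where $\zeta>0$ and $\theta$ is a meromorphic function without zeros in the closed disk $|z|\le\zeta$. Then for every $q\in(0,1)$,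 as $n\to\infty$, $$(-1)^{n+1}g_n\sim\frac{1}{q^{\binom n2}\,\zeta^n\,\tilde\phi'(\zeta)\,\prod_{j\ge1}(1-q^j)\,\prod_{j\ge 1}\theta(\zeta q^j)},$$ both infinite products being convergent. -/

import Mathlib

open Filter Topology Asymptotics
open PowerSeries (coeff constantCoeff rescale)

namespace QLagrange

/-- The value at `x` of the (real) power series `p`, meant where the series converges. -/
noncomputable def psEval (p : PowerSeries ℝ) (x : ℝ) : ℝ :=
  ∑' n : ℕ, coeff n p * x ^ n

/-- `g` is the right inverse of `f` (for the parameter `q`): `g` has no constant term and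
`∑_{n ≥ 1} f_n g(z) g(z/q) ⋯ g(z/q^(n-1)) = z` as formal power series.
Here `rescale c g` is `g(c z)`. As `g` has no constant term, the `n`-th product is divisible by
`z ^ n`, so that exactly the terms `1 ≤ n ≤ m` can contribute to the coefficient of `z ^ m`. -/
def IsRightInverse (q : ℝ) (f g : PowerSeries ℝ) : Prop :=
  constantCoeff g = 0 ∧
    ∀ m : ℕ, ∑ n ∈ Finset.Icc 1 m,
      coeff n f * coeff m (∏ k ∈ Finset.range n, rescale ((1 / q) ^ k) g) =
        coeff m (PowerSeries.X : PowerSeries ℝ)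

/-- Regular variation at infinity, with index `r`. -/
def RegularlyVarying (h : ℝ → ℝ) (r : ℝ) : Prop :=
  ∀ l : ℝ, 0 < l → Tendsto (fun t : ℝ => h (l * t) / h t) atTop (𝓝 (l ^ r))

/-- A sequence is regularly varying if the function that is constant on the intervals
`[n, n + 1)` with the values of the sequence is so. -/
def RegularlyVaryingSeq (c : ℕ → ℝ) (r : ℝ) : Prop :=
  RegularlyVarying (fun t : ℝ => c ⌊t⌋₊) r

/-! ### Three modes of convergence of polynomials `a_n(q)` to a power series `L(q)` on a set -/

/-- Convergence in limit infimum (taken in the extended reals). -/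
def ConvergesLiminf (a : ℕ → Polynomial ℝ) (L : PowerSeries ℝ) (A : Set ℝ) : Prop :=
  ∀ q ∈ A, liminf (fun n : ℕ => (((a n).eval q : ℝ) : EReal)) atTop = ((psEval L q : ℝ) : EReal)

open Classical in
/-- Convergence except on a set of integers of density `0`. -/
def ConvergesOffDensityZero (a : ℕ → Polynomial ℝ) (L : PowerSeries ℝ) (A : Set ℝ) : Prop :=
  ∀ δ : ℝ, 0 < δ → ∀ q ∈ A,
    Tendsto (fun n : ℕ => (1 / (n : ℝ)) *
      ∑ i ∈ Finset.Icc 1 n, if δ ≤ |(a i).eval q - psEval L q| then (1 : ℝ) else 0)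
      atTop (𝓝 0)

/-- Coefficientwise convergence. -/
def ConvergesCoeffwise (a : ℕ → Polynomial ℝ) (L : PowerSeries ℝ) : Prop :=
  ∀ j : ℕ, Tendsto (fun n : ℕ => (a n).coeff j) atTop (𝓝 (coeff j L))

/-! ### The regularly varying case -/

/-- The assumptions on the power series `φ`, with `ζ` and `ρ` the numbers they introduce. -/
structure RegVarAssumptions (φ : PowerSeries ℝ) (ζ ρ : ℝ) : Prop where
  nonneg : ∀ i : ℕ, 1 ≤ i → 0 ≤ coeff i φ
  /-- `ζ = min {x > 0 : φ(x) = 1}` -/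
  zeta_isLeast : IsLeast {x : ℝ | 0 < x ∧ HasSum (fun n : ℕ => coeff n φ * x ^ n) 1} ζ
  ratio : ∀ j : ℕ, ∃ l : ℝ, 0 ≤ l ∧
    Tendsto (fun n : ℕ => coeff (j + n) φ / coeff n φ) atTop (𝓝 l)
  rho_mem : ρ - 1 ∈ Set.Ioc (-1 : ℝ) 0
  /-- `[z^n] 1 / (1 - φ(ζ z))` is regularly varying of index `ρ - 1` -/
  regVar : RegularlyVaryingSeq (fun n : ℕ => coeff n (1 - rescale ζ φ)⁻¹) (ρ - 1)

/-- For `q` in `(0, 1)`, the quantities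
`ζ^n n (1 - φ(ζ(1 - 1/n))) q^(n choose 2) γ_n(q)`, `n ≥ 1`, are polynomials `a_n(q)` and
`ζ / (Γ(ρ) ∏_{j ≥ 1} (1 - φ(ζ q^j)))` is a (convergent) power series `L(q)`, both of them
being determined by their values on `(0, 1)`, and `a_n` converges to `L` in the three modes. -/
def RegVarConclusion (φ : PowerSeries ℝ) (ζ ρ : ℝ) (γ : ℝ → ℕ → ℝ) : Prop :=
  ∃ (a : ℕ → Polynomial ℝ) (L : PowerSeries ℝ),
    (∀ n : ℕ, 1 ≤ n → ∀ q ∈ Set.Ioo (0 : ℝ) 1,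
      (a n).eval q =
        ζ ^ n * n * (1 - psEval φ (ζ * (1 - 1 / (n : ℝ)))) * q ^ (n.choose 2) * γ q n) ∧
    (∀ q ∈ Set.Ioo (0 : ℝ) 1,
      Multipliable (fun j : ℕ => 1 - psEval φ (ζ * q ^ (j + 1))) ∧
      HasSum (fun j : ℕ => coeff j L * q ^ j)
        (ζ / (Real.Gamma ρ * ∏' j : ℕ, (1 - psEval φ (ζ * q ^ (j + 1)))))) ∧
    ConvergesLiminf a L (Set.Ioo 0 1) ∧
    ConvergesOffDensityZero a L (Set.Ioo 0 1) ∧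
    ConvergesCoeffwise a L

/-! ### The case of superexponentially small coefficients -/

/-- The assumptions on the power series `φ`, with `ζ` and `θ` the number and the function that
they introduce. In `limsup` one has `log 0 = -∞`, which `ENNReal.log` provides. -/
structure SuperexpAssumptions (φ : PowerSeries ℝ) (ζ : ℝ) (θ : ℂ → ℂ) : Prop where
  nonneg : ∀ n : ℕ, 0 ≤ coeff n φ
  decay : limsup (fun n : ℕ => ENNReal.log (ENNReal.ofReal (coeff n φ)) /
    (((n : ℝ) * Real.log n : ℝ) : EReal)) atTop < ((-2 : ℝ) : EReal)
  zeta_pos : 0 < ζ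
  meromorphic : MeromorphicOn θ Set.univ
  /-- `φ(z) = 1 - (1 - z/ζ) θ(z)`; at `z = ζ` this says `φ(ζ) = 1` -/
  factor : ∀ z : ℂ, HasSum (fun n : ℕ => ((coeff n φ : ℝ) : ℂ) * z ^ n)
    (1 - (1 - z / (ζ : ℂ)) * θ z)
  no_root : ∀ z : ℂ, ‖z‖ ≤ ζ → θ z ≠ 0

/-- `γ_n ∼ 1 / (q^(n choose 2) ζ^n φ'(ζ) (q;q)_∞ ∏_{j ≥ 1} θ(ζ q^j))` as `n → ∞`, the infinite
products being convergent. -/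
def SuperexpConclusion (φ : PowerSeries ℝ) (ζ : ℝ) (θ : ℂ → ℂ) (q : ℝ) (γ : ℕ → ℝ) : Prop :=
  Multipliable (fun j : ℕ => 1 - q ^ (j + 1)) ∧
  Multipliable (fun j : ℕ => θ ((ζ * q ^ (j + 1) : ℝ) : ℂ)) ∧
  (fun n : ℕ => ((γ n : ℝ) : ℂ)) ~[atTop] (fun n : ℕ =>
    1 / (((q ^ (n.choose 2) * ζ ^ n * deriv (psEval φ) ζ * ∏' j : ℕ, (1 - q ^ (j + 1)) : ℝ) : ℂ) *
      ∏' j : ℕ, θ ((ζ * q ^ (j + 1) : ℝ) : ℂ)))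

end QLagrange

/-
After `z` is rescaled by `-ζ`, the series `φ` becomes the generating function `p` of a probability
distribution on the positive integers, `g` becomes the right inverse of `z (1 - p(z))`, and
`q ^ (n choose 2) g_n` becomes a polynomial in `q` with nonnegative coefficients.

Writing `g(z) = z H(z/q) / H(z)` linearises the equation. With `B_n = q ^ ((n + 1) choose 2) H_n` it
reads `(1 - p(z)) B(z/q) = B(z)`, so that `B(z) = ∏_{j ≥ 1} 1 / (1 - p(q ^ j z))`, and
`q ^ ((n + 1) choose 2) g_{n+1}` differs by `O(n q ^ n)` from the coefficient of `z ^ n` in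
`B(z/q) = B(z) / (1 - p(z))`. Since the coefficients of `B` decay geometrically, this coefficient is
equivalent to `B(1) c_n`, where `c_n = [z ^ n] 1 / (1 - p(z))`, as soon as `c_n ∼ c_{n+1}`.

In (A), Karamata's Abelian theorem turns the regular variation of `c_n` into
`n (1 - p(1 - 1/n)) c_n → 1 / Γ(ρ)`, and for polynomials with nonnegative coefficients convergence
on an interval gives convergence of the coefficients. In (B), `(1 - z) / (1 - p(z))` is analytic on
a disk larger than the unit disk, so that `c_n` tends to the inverse of the mean of `p`.
-/

namespace QLagrange

section RightInverse

theorem choose_two_add (a b : ℕ) : (a + b).choose 2 = a.choose 2 + b.choose 2 + a * b := by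
  have succ (n : ℕ) : (n + 1).choose 2 = n.choose 2 + n := by
    rw [Nat.choose_succ_succ' n 1, Nat.choose_one_right, add_comm]
  induction b with
  | zero => simp
  | succ b ih => rw [← add_assoc, succ, ih, succ b]; ring

theorem choose_two_add_add_one (a b : ℕ) :
    (a + b + 1).choose 2 = (a + 1).choose 2 + (b + 1).choose 2 + a * b := by
  rw [choose_two_add (a + b), choose_two_add a b, choose_two_add a 1, choose_two_add b 1,
    Nat.choose_eq_zero_of_lt one_lt_two]
  ring

theorem prod_rescale_C_mul_rescale (c r : ℝ) (g : PowerSeries ℝ) (n : ℕ) :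
    ∏ k ∈ Finset.range n, rescale (r ^ k) (PowerSeries.C c⁻¹ * rescale c g) =
      PowerSeries.C (c⁻¹ ^ n) * rescale c (∏ k ∈ Finset.range n, rescale (r ^ k) g) := by
  have factor (k : ℕ) : rescale (r ^ k) (PowerSeries.C c⁻¹ * rescale c g) =
      PowerSeries.C c⁻¹ * rescale c (rescale (r ^ k) g) := by
    rw [map_mul, PowerSeries.rescale_rescale, PowerSeries.rescale_rescale, mul_comm c]
    congr 1
    ext m
    rw [PowerSeries.coeff_rescale, PowerSeries.coeff_C]
    split_ifs with hm <;> simp [hm]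
  simp only [factor, Finset.prod_mul_distrib, Finset.prod_const, Finset.card_range, map_prod,
    map_pow]

namespace IsRightInverse

variable {q c : ℝ} {f g H : PowerSeries ℝ}

theorem conj (h : IsRightInverse q f g) (hc : c ≠ 0) :
    IsRightInverse q (PowerSeries.C c⁻¹ * rescale c f) (PowerSeries.C c⁻¹ * rescale c g) := by
  refine ⟨by simp [← PowerSeries.coeff_zero_eq_constantCoeff_apply, PowerSeries.coeff_rescale,
    h.1], fun m => ?_⟩
  have term (n : ℕ) : coeff n (PowerSeries.C c⁻¹ * rescale c f) *
      coeff m (∏ k ∈ Finset.range n,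
        rescale ((1 / q) ^ k) (PowerSeries.C c⁻¹ * rescale c g)) =
      c⁻¹ * c ^ m * (coeff n f * coeff m (∏ k ∈ Finset.range n, rescale ((1 / q) ^ k) g)) := by
    rw [prod_rescale_C_mul_rescale]
    simp only [PowerSeries.coeff_C_mul, PowerSeries.coeff_rescale, inv_pow]
    field_simp
  simp only [term, ← Finset.mul_sum, h.2 m, PowerSeries.coeff_X]
  split_ifs with hm
  · simp [hm, hc]
  · simp

theorem coeff_prod_eq_zero (h : IsRightInverse q f g) (r : ℝ) {n m : ℕ} (hm : m < n) :
    coeff m (∏ k ∈ Finset.range n, rescale (r ^ k) g) = 0 := by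
  have dvd (k : ℕ) : (PowerSeries.X : PowerSeries ℝ) ∣ rescale (r ^ k) g := by
    rw [PowerSeries.X_dvd_iff, ← PowerSeries.coeff_zero_eq_constantCoeff_apply,
      PowerSeries.coeff_rescale, PowerSeries.coeff_zero_eq_constantCoeff_apply, h.1, mul_zero]
  have pow_dvd := Finset.prod_dvd_prod_of_dvd (s := Finset.range n) _ _ fun k _ => dvd k
  rw [Finset.prod_const, Finset.card_range] at pow_dvd
  exact PowerSeries.X_pow_dvd_iff.1 pow_dvd m hm

theorem sum_eq_coeff_X (h : IsRightInverse q f g) {m M : ℕ} (hm : m ≤ M) :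
    ∑ n ∈ Finset.Icc 1 M, coeff n f * coeff m (∏ k ∈ Finset.range n, rescale ((1 / q) ^ k) g) =
      coeff m (PowerSeries.X : PowerSeries ℝ) := by
  rw [← h.2 m]
  refine (Finset.sum_subset (Finset.Icc_subset_Icc_right hm) fun n hn hn' => ?_).symm
  rw [Finset.mem_Icc] at hn hn'
  rw [h.coeff_prod_eq_zero _ (by omega), mul_zero]

end IsRightInverse

theorem prod_rescale_mul {r : ℝ} {g H : PowerSeries ℝ}
    (hH : PowerSeries.X * rescale r H = g * H) (n : ℕ) :
    (∏ k ∈ Finset.range n, rescale (r ^ k) g) * H =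
      PowerSeries.C (r ^ n.choose 2) * PowerSeries.X ^ n * rescale (r ^ n) H := by
  induction n with
  | zero => simp
  | succ n ih =>
    have shifted := congrArg (rescale (r ^ n)) hH
    rw [map_mul, map_mul, PowerSeries.rescale_rescale, PowerSeries.rescale_X, mul_comm r,
      ← pow_succ] at shifted
    rw [Finset.prod_range_succ, mul_right_comm, ih, mul_assoc _ _ (rescale (r ^ n) g),
      mul_comm (rescale (r ^ n) H), ← shifted, choose_two_add n 1,
      Nat.choose_eq_zero_of_lt one_lt_two, add_zero, mul_one, pow_add r (n.choose 2), map_mul]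
    ring

theorem coeff_prod_rescale_mul {r : ℝ} {g H : PowerSeries ℝ}
    (hH : PowerSeries.X * rescale r H = g * H) {n m : ℕ} (hn : n ≤ m) :
    coeff m ((∏ k ∈ Finset.range n, rescale (r ^ k) g) * H) =
      r ^ (n.choose 2 + n * (m - n)) * coeff (m - n) H := by
  rw [prod_rescale_mul hH, mul_assoc, PowerSeries.coeff_C_mul, PowerSeries.coeff_X_pow_mul',
    if_pos hn, PowerSeries.coeff_rescale, pow_add, pow_mul, mul_assoc]

/- Multiplying the defining equation of `g` by `H` linearises it. -/
theorem IsRightInverse.sum_mul_coeff_eq {q : ℝ} {f g H : PowerSeries ℝ}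
    (h : IsRightInverse q f g) (hH : PowerSeries.X * rescale (1 / q) H = g * H) (m : ℕ) :
    ∑ n ∈ Finset.Icc 1 m,
      coeff n f * ((1 / q) ^ (n.choose 2 + n * (m - n)) * coeff (m - n) H) =
      coeff m (PowerSeries.X * H) := by
  have expand : coeff m (PowerSeries.X * H) = ∑ x ∈ Finset.HasAntidiagonal.antidiagonal m,
      (∑ n ∈ Finset.Icc 1 m,
        coeff n f * coeff x.1 (∏ k ∈ Finset.range n, rescale ((1 / q) ^ k) g)) * coeff x.2 H := by
    rw [PowerSeries.coeff_mul]
    refine Finset.sum_congr rfl fun x hx => ?_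
    rw [h.sum_eq_coeff_X (Finset.HasAntidiagonal.antidiagonal.fst_le hx)]
  simp only [expand, Finset.sum_mul, mul_assoc]
  rw [Finset.sum_comm]
  refine Finset.sum_congr rfl fun n hn => ?_
  rw [← Finset.mul_sum, ← PowerSeries.coeff_mul,
    coeff_prod_rescale_mul hH (Finset.mem_Icc.1 hn).2]

end RightInverse

section NonnegPolynomials

/-- The functions on `(0, 1)` given by polynomials with nonnegative coefficients. -/
noncomputable def nonnegPolynomialFunctions : Subsemiring (Set.Ioo (0 : ℝ) 1 → ℝ) :=
  (RingHom.pi fun q : Set.Ioo (0 : ℝ) 1 =>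
    Polynomial.eval₂RingHom NNReal.toRealHom (q : ℝ)).rangeS

theorem const_mem_nonnegPolynomialFunctions {a : ℝ} (ha : 0 ≤ a) :
    (fun _ => a) ∈ nonnegPolynomialFunctions :=
  ⟨Polynomial.C ⟨a, ha⟩, funext fun _ => Polynomial.eval₂_C _ _⟩

theorem pow_mem_nonnegPolynomialFunctions (k : ℕ) :
    (fun q : Set.Ioo (0 : ℝ) 1 => (q : ℝ) ^ k) ∈ nonnegPolynomialFunctions :=
  ⟨Polynomial.X ^ k, funext fun _ => Polynomial.eval₂_X_pow _ _⟩

theorem exists_polynomial_of_mem {F : Set.Ioo (0 : ℝ) 1 → ℝ}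
    (hF : F ∈ nonnegPolynomialFunctions) :
    ∃ P : Polynomial ℝ, (∀ j, 0 ≤ P.coeff j) ∧ ∀ q : Set.Ioo (0 : ℝ) 1, P.eval (q : ℝ) = F q := by
  obtain ⟨P, rfl⟩ := hF
  refine ⟨P.map NNReal.toRealHom, fun j => ?_, fun q => ?_⟩
  · rw [Polynomial.coeff_map]
    exact NNReal.coe_nonneg _
  · exact Polynomial.eval_map _ _

theorem nonneg_of_mem_nonnegPolynomialFunctions {F : Set.Ioo (0 : ℝ) 1 → ℝ}
    (hF : F ∈ nonnegPolynomialFunctions) (q : Set.Ioo (0 : ℝ) 1) : 0 ≤ F q := by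
  obtain ⟨P, coeff_nonneg, eval_eq⟩ := exists_polynomial_of_mem hF
  rw [← eval_eq q, Polynomial.eval_eq_sum]
  exact Finset.sum_nonneg fun i _ => mul_nonneg (coeff_nonneg i) (pow_nonneg q.2.1.le i)

theorem pow_choose_two_add_mul {q : ℝ} (hq : q ≠ 0) {n i : ℕ} (hn : n ≤ i) (j : ℕ) (x y : ℝ) :
    q ^ (i + j).choose 2 * (x * (((1 / q) ^ n) ^ j * y)) =
      q ^ ((i - n) * j) * ((q ^ i.choose 2 * x) * (q ^ j.choose 2 * y)) := by
  obtain ⟨d, rfl⟩ := Nat.exists_eq_add_of_le hn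
  rw [choose_two_add (n + d) j, Nat.add_sub_cancel_left, ← pow_mul, one_div, inv_pow, add_mul]
  simp only [pow_add]
  field_simp

theorem coeff_prod_mem_nonnegPolynomialFunctions {f : PowerSeries ℝ} {g : ℝ → PowerSeries ℝ}
    (hg : ∀ q ∈ Set.Ioo (0 : ℝ) 1, IsRightInverse q f (g q)) {M : ℕ}
    (hM : ∀ a < M, (fun q : Set.Ioo (0 : ℝ) 1 => (q : ℝ) ^ a.choose 2 * coeff a (g q)) ∈
      nonnegPolynomialFunctions) (n : ℕ) :
    ∀ m, m + 1 < M + n → (fun q : Set.Ioo (0 : ℝ) 1 => (q : ℝ) ^ m.choose 2 *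
      coeff m (∏ k ∈ Finset.range n, rescale ((1 / (q : ℝ)) ^ k) (g q))) ∈
        nonnegPolynomialFunctions := by
  induction n with
  | zero =>
    intro m _
    refine mul_mem (pow_mem_nonnegPolynomialFunctions _) ?_
    simp only [Finset.range_zero, Finset.prod_empty, PowerSeries.coeff_one]
    exact const_mem_nonnegPolynomialFunctions (by split_ifs <;> simp)
  | succ n ih =>
    intro m hm
    have expand : (fun q : Set.Ioo (0 : ℝ) 1 => (q : ℝ) ^ m.choose 2 *
        coeff m (∏ k ∈ Finset.range (n + 1), rescale ((1 / (q : ℝ)) ^ k) (g q))) =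
        ∑ x ∈ Finset.HasAntidiagonal.antidiagonal m, fun q : Set.Ioo (0 : ℝ) 1 =>
          (q : ℝ) ^ m.choose 2 *
            (coeff x.1 (∏ k ∈ Finset.range n, rescale ((1 / (q : ℝ)) ^ k) (g q)) *
              (((1 / (q : ℝ)) ^ n) ^ x.2 * coeff x.2 (g q))) := by
      ext q
      simp only [Finset.prod_range_succ, PowerSeries.coeff_mul, PowerSeries.coeff_rescale,
        Finset.mul_sum, Finset.sum_apply]
    rw [expand]
    refine sum_mem fun x hx => ?_
    obtain rfl := Finset.HasAntidiagonal.mem_antidiagonal.1 hx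
    by_cases h : x.1 < n ∨ x.2 = 0
    · convert zero_mem nonnegPolynomialFunctions with q
      rcases h with h | h
      · rw [(hg q q.2).coeff_prod_eq_zero _ h, zero_mul, mul_zero, Pi.zero_apply]
      · simp [h, (hg q q.2).1]
    · push Not at h
      have regroup (q : Set.Ioo (0 : ℝ) 1) := pow_choose_two_add_mul q.2.1.ne' h.1 x.2
      simp only [regroup]
      exact mul_mem (pow_mem_nonnegPolynomialFunctions _)
        (mul_mem (ih _ (by omega)) (hM _ (by omega)))

theorem sum_Icc_one (F : ℕ → ℝ) (m : ℕ) :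
    ∑ n ∈ Finset.Icc 1 m, F n = ∑ n ∈ Finset.range m, F (n + 1) := by
  rw [← Finset.Ico_add_one_right_eq_Icc, Finset.sum_Ico_eq_sum_range, Nat.add_sub_cancel]
  simp only [add_comm]

theorem IsRightInverse.coeff_add_one_eq {q : ℝ} {p g : PowerSeries ℝ} (hp : constantCoeff p = 0)
    (h : IsRightInverse q (PowerSeries.X * (1 - p)) g) (m : ℕ) :
    coeff (m + 1) g = coeff m (1 : PowerSeries ℝ) + ∑ n ∈ Finset.range m,
      coeff (n + 1) p *
        coeff (m + 1) (∏ k ∈ Finset.range (n + 2), rescale ((1 / q) ^ k) g) := by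
  have zeroth : coeff 0 (1 - p) = 1 := by simp [hp]
  have higher (n : ℕ) : coeff (n + 1) (1 - p) = -coeff (n + 1) p := by
    simp [PowerSeries.coeff_one]
  have defining := h.2 (m + 1)
  rw [sum_Icc_one, Finset.sum_range_succ', ← mul_one (PowerSeries.X : PowerSeries ℝ),
    PowerSeries.coeff_succ_X_mul] at defining
  simp only [mul_one, PowerSeries.coeff_succ_X_mul, zeroth, higher, zero_add, Finset.prod_range_one,
    pow_zero, PowerSeries.rescale_one, RingHom.id_apply, one_mul, neg_mul,
    Finset.sum_neg_distrib, add_assoc, Nat.reduceAdd] at defining ⊢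
  linarith

theorem coeff_mem_nonnegPolynomialFunctions {p : PowerSeries ℝ} (hp0 : constantCoeff p = 0)
    (hp : ∀ n, 0 ≤ coeff n p) {g : ℝ → PowerSeries ℝ}
    (hg : ∀ q ∈ Set.Ioo (0 : ℝ) 1, IsRightInverse q (PowerSeries.X * (1 - p)) (g q)) (m : ℕ) :
    (fun q : Set.Ioo (0 : ℝ) 1 => (q : ℝ) ^ m.choose 2 * coeff m (g q)) ∈
      nonnegPolynomialFunctions := by
  induction m using Nat.strong_induction_on with
  | _ m ih =>
    cases m with
    | zero =>
      convert zero_mem nonnegPolynomialFunctions with q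
      simp [(hg q q.2).1]
    | succ m =>
      have expand : (fun q : Set.Ioo (0 : ℝ) 1 =>
          (q : ℝ) ^ (m + 1).choose 2 * coeff (m + 1) (g q)) =
          (fun q : Set.Ioo (0 : ℝ) 1 => (q : ℝ) ^ (m + 1).choose 2) *
            (fun _ => coeff m (1 : PowerSeries ℝ)) +
          ∑ n ∈ Finset.range m, (fun _ => coeff (n + 1) p) *
            fun q : Set.Ioo (0 : ℝ) 1 => (q : ℝ) ^ (m + 1).choose 2 *
              coeff (m + 1) (∏ k ∈ Finset.range (n + 2), rescale ((1 / (q : ℝ)) ^ k) (g q)) := by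
        ext q
        simp only [(hg q q.2).coeff_add_one_eq hp0, Pi.add_apply, Pi.mul_apply, Finset.sum_apply,
          mul_add, Finset.mul_sum, mul_left_comm]
      rw [expand]
      refine add_mem (mul_mem (pow_mem_nonnegPolynomialFunctions _)
        (const_mem_nonnegPolynomialFunctions ?_)) (sum_mem fun n _ => mul_mem
          (const_mem_nonnegPolynomialFunctions (hp _))
          (coeff_prod_mem_nonnegPolynomialFunctions hg ih _ _ (by omega)))
      rw [PowerSeries.coeff_one]
      split_ifs <;> simp

end NonnegPolynomials

section QProduct

/-- The coefficients of the series `H` with `H(0) = 1` and `z H(r z) = g(z) H(z)`. -/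
noncomputable def ratioCoeff (r : ℝ) (g : PowerSeries ℝ) : ℕ → ℝ
  | 0 => 1
  | m + 1 => (r ^ (m + 1) - 1)⁻¹ * ∑ i : Fin (m + 1), coeff (m + 1 - i + 1) g * ratioCoeff r g i

theorem pow_mul_ratioCoeff {r : ℝ} (hr : 1 < r) {g : PowerSeries ℝ} (hg : coeff 1 g = 1)
    (m : ℕ) : r ^ m * ratioCoeff r g m =
      ∑ i ∈ Finset.range (m + 1), coeff (m - i + 1) g * ratioCoeff r g i := by
  cases m with
  | zero => simp [ratioCoeff, hg]
  | succ m =>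
    have ne : r ^ (m + 1) - 1 ≠ 0 := (sub_pos.2 (one_lt_pow₀ hr m.succ_ne_zero)).ne'
    have recursion : (r ^ (m + 1) - 1) * ratioCoeff r g (m + 1) =
        ∑ i ∈ Finset.range (m + 1), coeff (m + 1 - i + 1) g * ratioCoeff r g i := by
      conv_lhs => rw [ratioCoeff]
      rw [mul_inv_cancel_left₀ ne,
        Finset.sum_range fun i => coeff (m + 1 - i + 1) g * ratioCoeff r g i]
    rw [Finset.sum_range_succ, ← recursion, Nat.sub_self, zero_add, hg]
    ring

theorem X_mul_rescale_mk_ratioCoeff {r : ℝ} (hr : 1 < r) {g : PowerSeries ℝ}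
    (hg₀ : constantCoeff g = 0) (hg₁ : coeff 1 g = 1) :
    PowerSeries.X * rescale r (PowerSeries.mk (ratioCoeff r g)) =
      g * PowerSeries.mk (ratioCoeff r g) := by
  obtain ⟨k, rfl⟩ := PowerSeries.X_dvd_iff.2 hg₀
  rw [mul_assoc]
  congr 1
  ext m
  rw [PowerSeries.coeff_rescale, PowerSeries.coeff_mk, pow_mul_ratioCoeff hr hg₁, mul_comm k,
    PowerSeries.coeff_mul, Finset.Nat.sum_antidiagonal_eq_sum_range_succ_mk]
  refine Finset.sum_congr rfl fun i _ => ?_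
  rw [PowerSeries.coeff_succ_X_mul, PowerSeries.coeff_mk, mul_comm]

/-- `B` is the formal product `∏_{j ≥ 1} 1 / (1 - p(q^j z))`, characterised by the functional
equation `(1 - p(z)) B(z / q) = B(z)`. -/
structure IsQProduct (q : ℝ) (p B : PowerSeries ℝ) : Prop where
  functional_eq : (1 - p) * rescale (1 / q) B = B
  coeff_zero : coeff 0 B = 1

/-- The formal product of `IsQProduct`, expressed through the right inverse `g` of
`z (1 - p(z))`. -/
noncomputable def prodSeries (q : ℝ) (g : PowerSeries ℝ) : PowerSeries ℝ :=
  PowerSeries.mk fun m => q ^ (m + 1).choose 2 * ratioCoeff (1 / q) g m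

namespace IsRightInverse

variable {q : ℝ} {p g : PowerSeries ℝ}

theorem coeff_one (hp : constantCoeff p = 0)
    (h : IsRightInverse q (PowerSeries.X * (1 - p)) g) : coeff 1 g = 1 := by
  simpa using h.coeff_add_one_eq hp 0

theorem isQProduct_prodSeries (hp : constantCoeff p = 0) (hq : q ∈ Set.Ioo (0 : ℝ) 1)
    (h : IsRightInverse q (PowerSeries.X * (1 - p)) g) : IsQProduct q p (prodSeries q g) where
  functional_eq := by
    have hq₀ : q ≠ 0 := hq.1.ne'
    ext m
    have linear := h.sum_mul_coeff_eq
      (X_mul_rescale_mk_ratioCoeff (one_lt_one_div hq.1 hq.2) h.1 (h.coeff_one hp)) (m + 1)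
    simp only [sum_Icc_one, PowerSeries.coeff_succ_X_mul, PowerSeries.coeff_mk] at linear
    rw [PowerSeries.coeff_mul, Finset.Nat.sum_antidiagonal_eq_sum_range_succ_mk, prodSeries,
      PowerSeries.coeff_mk, ← linear, Finset.mul_sum]
    refine Finset.sum_congr rfl fun i hi => ?_
    obtain ⟨j, rfl⟩ := Nat.exists_eq_add_of_le (Nat.lt_succ_iff.1 (Finset.mem_range.1 hi))
    rw [PowerSeries.coeff_rescale, PowerSeries.coeff_mk, Nat.add_sub_add_right,
      Nat.add_sub_cancel_left, choose_two_add_add_one]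
    simp only [pow_add, one_div, inv_pow, add_mul, one_mul]
    field_simp
  coeff_zero := by simp [prodSeries, ratioCoeff]

theorem coeff_rescale_prodSeries (hp : constantCoeff p = 0) (hq : q ∈ Set.Ioo (0 : ℝ) 1)
    (h : IsRightInverse q (PowerSeries.X * (1 - p)) g) (n : ℕ) :
    coeff n (rescale (1 / q) (prodSeries q g)) =
      ∑ i ∈ Finset.range (n + 1), coeff i (prodSeries q g) * q ^ (i * (n - i)) *
        (q ^ (n - i + 1).choose 2 * coeff (n - i + 1) g) := by
  rw [PowerSeries.coeff_rescale, prodSeries, PowerSeries.coeff_mk, mul_left_comm,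
    pow_mul_ratioCoeff (one_lt_one_div hq.1 hq.2) (h.coeff_one hp) n, Finset.mul_sum]
  refine Finset.sum_congr rfl fun i hi => ?_
  obtain ⟨j, rfl⟩ := Nat.exists_eq_add_of_le (Nat.lt_succ_iff.1 (Finset.mem_range.1 hi))
  rw [PowerSeries.coeff_mk, Nat.add_sub_cancel_left, choose_two_add_add_one]
  simp only [pow_add]
  ring

end IsRightInverse

end QProduct

section Evaluation

theorem psEval_rescale (a : ℝ) (p : PowerSeries ℝ) (x : ℝ) :
    psEval (rescale a p) x = psEval p (a * x) := by
  simp only [psEval, PowerSeries.coeff_rescale, mul_pow]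
  exact tsum_congr fun n => by ring

theorem hasSum_coeff_mul {s t : PowerSeries ℝ} {x a b : ℝ}
    (hs : HasSum (fun n => coeff n s * x ^ n) a) (ht : HasSum (fun n => coeff n t * x ^ n) b) :
    HasSum (fun n => coeff n (s * t) * x ^ n) (a * b) := by
  have cauchy (n : ℕ) : coeff n (s * t) * x ^ n = ∑ k ∈ Finset.HasAntidiagonal.antidiagonal n,
      (coeff k.1 s * x ^ k.1) * (coeff k.2 t * x ^ k.2) := by
    rw [PowerSeries.coeff_mul, Finset.sum_mul]
    refine Finset.sum_congr rfl fun k hk => ?_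
    rw [← Finset.HasAntidiagonal.mem_antidiagonal.1 hk, pow_add]
    ring
  have hs' := hs.summable.norm
  have ht' := ht.summable.norm
  simp only [cauchy]
  rw [← hs.tsum_eq, ← ht.tsum_eq, tsum_mul_tsum_eq_tsum_sum_antidiagonal_of_summable_norm hs' ht']
  exact (summable_norm_sum_mul_antidiagonal_of_summable_norm hs' ht').of_norm.hasSum

theorem hasSum_coeff_one (x : ℝ) :
    HasSum (fun n => coeff n (1 : PowerSeries ℝ) * x ^ n) 1 := by
  have := hasSum_single (f := fun n => coeff n (1 : PowerSeries ℝ) * x ^ n) 0 fun n hn => by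
    simp [PowerSeries.coeff_one, hn]
  simpa using this

theorem summable_coeff_mul_pow {p : PowerSeries ℝ} {K : ℝ} (h : ∀ n, |coeff n p| ≤ K) {x : ℝ}
    (hx : |x| < 1) : Summable fun n => coeff n p * x ^ n := by
  refine Summable.of_norm_bounded
    ((summable_geometric_of_lt_one (abs_nonneg x) hx).mul_left K) fun n => ?_
  rw [norm_mul, norm_pow, Real.norm_eq_abs, Real.norm_eq_abs]
  exact mul_le_mul_of_nonneg_right (h n) (by positivity)

end Evaluation

/-- The generating function of a probability distribution on the positive integers. -/
structure IsProbSeries (p : PowerSeries ℝ) : Prop where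
  constantCoeff_eq : constantCoeff p = 0
  nonneg : ∀ n, 0 ≤ coeff n p
  hasSum : HasSum (fun n => coeff n p) 1

namespace IsProbSeries

variable {p : PowerSeries ℝ} {x : ℝ} (hp : IsProbSeries p)
include hp

theorem abs_coeff_le_one (n : ℕ) : |coeff n p| ≤ 1 := by
  rw [abs_of_nonneg (hp.nonneg n)]
  exact le_hasSum hp.hasSum n fun m _ => hp.nonneg m

theorem one_sub_mul_inv : (1 - p) * (1 - p)⁻¹ = 1 :=
  PowerSeries.mul_inv_cancel _ (by simp [hp.constantCoeff_eq])

theorem coeff_inv_zero : coeff 0 (1 - p)⁻¹ = 1 := by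
  simp [hp.constantCoeff_eq]

theorem coeff_inv_succ (n : ℕ) : coeff (n + 1) (1 - p)⁻¹ =
    ∑ i ∈ Finset.range (n + 1), coeff (i + 1) p * coeff (n - i) (1 - p)⁻¹ := by
  have renewal := congrArg (coeff (n + 1)) hp.one_sub_mul_inv
  rw [sub_mul, one_mul, map_sub, PowerSeries.coeff_one, if_neg n.succ_ne_zero, sub_eq_zero]
    at renewal
  rw [renewal, PowerSeries.coeff_mul, Finset.Nat.sum_antidiagonal_eq_sum_range_succ_mk,
    Finset.sum_range_succ', PowerSeries.coeff_zero_eq_constantCoeff_apply, hp.constantCoeff_eq,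
    zero_mul, add_zero]
  exact Finset.sum_congr rfl fun i _ => by rw [Nat.add_sub_add_right]

theorem coeff_inv_mem_Icc (n : ℕ) : coeff n (1 - p)⁻¹ ∈ Set.Icc (0 : ℝ) 1 := by
  induction n using Nat.strong_induction_on with
  | _ n ih =>
    cases n with
    | zero => rw [hp.coeff_inv_zero]; norm_num
    | succ n =>
      rw [hp.coeff_inv_succ]
      refine ⟨Finset.sum_nonneg fun i _ => mul_nonneg (hp.nonneg _) (ih _ (by omega)).1, ?_⟩
      calc ∑ i ∈ Finset.range (n + 1), coeff (i + 1) p * coeff (n - i) (1 - p)⁻¹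
          ≤ ∑ i ∈ Finset.range (n + 1), coeff (i + 1) p :=
            Finset.sum_le_sum fun i _ =>
              mul_le_of_le_one_right (hp.nonneg _) (ih _ (by omega)).2
        _ ≤ ∑ i ∈ Finset.range (n + 2), coeff i p := by
            rw [Finset.sum_range_succ' _ (n + 1)]
            exact le_add_of_nonneg_right (hp.nonneg _)
        _ ≤ 1 := sum_le_hasSum _ (fun m _ => hp.nonneg m) hp.hasSum

theorem psEval_mem_Icc (hx₀ : 0 ≤ x) (hx₁ : x < 1) : psEval p x ∈ Set.Icc 0 x := by
  have summable : Summable fun n => coeff n p * x ^ n :=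
    summable_coeff_mul_pow hp.abs_coeff_le_one (by rwa [abs_of_nonneg hx₀])
  refine ⟨tsum_nonneg fun n => mul_nonneg (hp.nonneg n) (pow_nonneg hx₀ n), ?_⟩
  refine hasSum_le (fun n => ?_) summable.hasSum (by simpa using hp.hasSum.mul_right x)
  cases n with
  | zero => simp [hp.constantCoeff_eq]
  | succ n =>
    exact mul_le_mul_of_nonneg_left (pow_le_of_le_one hx₀ hx₁.le n.succ_ne_zero) (hp.nonneg _)

theorem hasSum_one_sub (hx : |x| < 1) :
    HasSum (fun n => coeff n (1 - p) * x ^ n) (1 - psEval p x) := by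
  simp only [map_sub, sub_mul]
  exact (hasSum_coeff_one x).sub (summable_coeff_mul_pow hp.abs_coeff_le_one hx).hasSum

theorem hasSum_inv (hx : |x| < 1) :
    HasSum (fun n => coeff n (1 - p)⁻¹ * x ^ n) (1 - psEval p x)⁻¹ := by
  have summable : Summable fun n => coeff n (1 - p)⁻¹ * x ^ n :=
    summable_coeff_mul_pow (K := 1) (fun n => by
      rw [abs_of_nonneg (hp.coeff_inv_mem_Icc n).1]
      exact (hp.coeff_inv_mem_Icc n).2) hx
  have product := hasSum_coeff_mul (hp.hasSum_one_sub hx) summable.hasSum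
  rw [hp.one_sub_mul_inv] at product
  rw [inv_eq_of_mul_eq_one_right (product.unique (hasSum_coeff_one x))]
  exact summable.hasSum

end IsProbSeries

section QProductAnalysis

theorem exists_le_of_succ_le_mul_one_add {S a : ℕ → ℝ} (hS : 0 ≤ S 0) (ha : ∀ n, 0 ≤ a n)
    (ha' : Summable a) (hSa : ∀ n, S (n + 1) ≤ S n * (1 + a n)) : ∃ K, ∀ n, S n ≤ K := by
  have le_exp (n : ℕ) : S n ≤ S 0 * Real.exp (∑ i ∈ Finset.range n, a i) := by
    induction n with
    | zero => simp
    | succ n ih =>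
      calc S (n + 1) ≤ S n * (1 + a n) := hSa n
        _ ≤ S 0 * Real.exp (∑ i ∈ Finset.range n, a i) * Real.exp (a n) :=
            mul_le_mul ih (add_comm (a n) 1 ▸ Real.add_one_le_exp _) (by linarith [ha n])
              (by positivity)
        _ = S 0 * Real.exp (∑ i ∈ Finset.range (n + 1), a i) := by
            rw [Finset.sum_range_succ, Real.exp_add, mul_assoc]
  exact ⟨S 0 * Real.exp (∑' i, a i), fun n => (le_exp n).trans (mul_le_mul_of_nonneg_left
    (Real.exp_le_exp.2 (ha'.sum_le_tsum _ fun i _ => ha i)) hS)⟩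

namespace IsQProduct

variable {p B : PowerSeries ℝ} {q : ℝ} (hp : IsProbSeries p) (hB : IsQProduct q p B)
include hp hB

theorem rescale_eq_mul_inv : rescale (1 / q) B = B * (1 - p)⁻¹ := by
  conv_rhs => rw [← hB.functional_eq]
  rw [mul_right_comm, hp.one_sub_mul_inv, one_mul]

theorem coeff_rescale_eq_sum (n : ℕ) : coeff n (rescale (1 / q) B) =
    ∑ i ∈ Finset.range (n + 1), coeff i B * coeff (n - i) (1 - p)⁻¹ := by
  rw [hB.rescale_eq_mul_inv hp, PowerSeries.coeff_mul,
    Finset.Nat.sum_antidiagonal_eq_sum_range_succ_mk]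

variable (hq : q ∈ Set.Ioo (0 : ℝ) 1)
include hq

theorem nonneg (n : ℕ) : 0 ≤ coeff n B := by
  induction n using Nat.strong_induction_on with
  | _ n ih =>
    rcases n.eq_zero_or_pos with rfl | hn
    · rw [hB.coeff_zero]
      exact zero_le_one
    · have sum_nonneg :
          0 ≤ ∑ i ∈ Finset.range n, coeff i B * coeff (n - i) (1 - p)⁻¹ :=
        Finset.sum_nonneg fun i hi =>
          mul_nonneg (ih i (Finset.mem_range.1 hi)) (hp.coeff_inv_mem_Icc _).1
      have recursion := hB.coeff_rescale_eq_sum hp n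
      rw [PowerSeries.coeff_rescale, Finset.sum_range_succ, Nat.sub_self, hp.coeff_inv_zero]
        at recursion
      refine nonneg_of_mul_nonneg_right (a := (1 / q) ^ n - 1) (by linarith)
        (sub_pos.2 (one_lt_pow₀ (one_lt_one_div hq.1 hq.2) hn.ne'))

theorem coeff_rescale_le_sum (n : ℕ) :
    coeff n (rescale (1 / q) B) ≤ ∑ i ∈ Finset.range (n + 1), coeff i B := by
  rw [hB.coeff_rescale_eq_sum hp]
  exact Finset.sum_le_sum fun i _ =>
    mul_le_of_le_one_right (hB.nonneg hp hq i) (hp.coeff_inv_mem_Icc _).2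

theorem sum_succ_le (n : ℕ) : ∑ i ∈ Finset.range (n + 1 + 1), coeff i B ≤
    (∑ i ∈ Finset.range (n + 1), coeff i B) * (1 + q ^ (n + 1) / (1 - q)) := by
  have hq' : 0 < 1 - q := sub_pos.2 hq.2
  have le := hB.coeff_rescale_le_sum hp hq (n + 1)
  rw [PowerSeries.coeff_rescale, one_div, inv_pow, inv_mul_le_iff₀ (pow_pos hq.1 _),
    Finset.sum_range_succ] at le
  have pow_le : q ^ (n + 1) ≤ q := pow_le_of_le_one hq.1.le hq.2.le n.succ_ne_zero
  rw [Finset.sum_range_succ, mul_add, mul_one, add_le_add_iff_left, ← mul_div_assoc,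
    le_div_iff₀ hq']
  nlinarith [mul_nonneg (hB.nonneg hp hq (n + 1)) (sub_nonneg.2 pow_le)]

theorem exists_coeff_rescale_le : ∃ K, ∀ n, coeff n (rescale (1 / q) B) ≤ K := by
  obtain ⟨K, sum_le⟩ := exists_le_of_succ_le_mul_one_add
    (S := fun n => ∑ i ∈ Finset.range (n + 1), coeff i B) (by simp [hB.coeff_zero])
    (fun n => div_nonneg (pow_nonneg hq.1.le _) (sub_nonneg.2 hq.2.le))
    (((summable_nat_add_iff 1).2 (summable_geometric_of_lt_one hq.1.le hq.2)).div_const _)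
    (hB.sum_succ_le hp hq)
  exact ⟨K, fun n => (hB.coeff_rescale_le_sum hp hq n).trans (sum_le n)⟩

theorem exists_coeff_le_mul_pow : ∃ K, ∀ n, coeff n B ≤ K * q ^ n := by
  obtain ⟨K, coeff_le⟩ := hB.exists_coeff_rescale_le hp hq
  refine ⟨K, fun n => ?_⟩
  have le := coeff_le n
  rwa [PowerSeries.coeff_rescale, one_div, inv_pow, inv_mul_le_iff₀ (pow_pos hq.1 n),
    mul_comm] at le

theorem summable_coeff : Summable fun n => coeff n B := by
  obtain ⟨K, coeff_le⟩ := hB.exists_coeff_le_mul_pow hp hq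
  exact Summable.of_nonneg_of_le (hB.nonneg hp hq) coeff_le
    ((summable_geometric_of_lt_one hq.1.le hq.2).mul_left K)

theorem coeff_mul_pow_le_coeff {x : ℝ} (hx₀ : 0 ≤ x) (hx₁ : x ≤ 1) (n : ℕ) :
    coeff n B * x ^ n ≤ coeff n B :=
  mul_le_of_le_one_right (hB.nonneg hp hq n) (pow_le_one₀ hx₀ hx₁)

theorem one_sub_psEval_mul_psEval (j : ℕ) :
    (1 - psEval p (q ^ (j + 1))) * psEval B (q ^ j) = psEval B (q ^ (j + 1)) := by
  have hqj : q ^ j ∈ Set.Icc (0 : ℝ) 1 := ⟨pow_nonneg hq.1.le j, pow_le_one₀ hq.1.le hq.2.le⟩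
  have summable : Summable fun n => coeff n B * (q ^ j) ^ n :=
    (hB.summable_coeff hp hq).of_nonneg_of_le
      (fun n => mul_nonneg (hB.nonneg hp hq n) (pow_nonneg hqj.1 n))
      (hB.coeff_mul_pow_le_coeff hp hq hqj.1 hqj.2)
  have hasSum_rescale : HasSum (fun n => coeff n (rescale (1 / q) B) * (q ^ (j + 1)) ^ n)
      (psEval B (q ^ j)) := by
    refine summable.hasSum.congr_fun fun n => ?_
    have hq₀ := hq.1.ne'
    rw [PowerSeries.coeff_rescale, pow_succ q j, mul_pow, one_div, inv_pow]
    field_simp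
  have abs_lt : |q ^ (j + 1)| < 1 := by
    rw [abs_of_pos (pow_pos hq.1 _)]
    exact pow_lt_one₀ hq.1.le hq.2 j.succ_ne_zero
  have product := hasSum_coeff_mul (hp.hasSum_one_sub abs_lt) hasSum_rescale
  rw [hB.functional_eq] at product
  exact product.tsum_eq.symm

theorem prod_mul_psEval_one (n : ℕ) :
    (∏ j ∈ Finset.range n, (1 - psEval p (q ^ (j + 1)))) * psEval B 1 = psEval B (q ^ n) := by
  induction n with
  | zero => simp
  | succ n ih =>
    rw [Finset.prod_range_succ, mul_right_comm, ih, mul_comm,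
      hB.one_sub_psEval_mul_psEval hp hq]

theorem tendsto_psEval_pow : Tendsto (fun n : ℕ => psEval B (q ^ n)) atTop (𝓝 1) := by
  have limit : Tendsto (fun n : ℕ => psEval B (q ^ n)) atTop
      (𝓝 (∑' m, if m = 0 then (1 : ℝ) else 0)) := by
    refine tendsto_tsum_of_dominated_convergence (hB.summable_coeff hp hq) (fun m => ?_)
      (Eventually.of_forall fun n m => ?_)
    · split_ifs with hm
      · simp [hm, hB.coeff_zero]
      · have pow_tendsto := (tendsto_pow_atTop_nhds_zero_of_lt_one hq.1.le hq.2).pow m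
        simpa [hm] using pow_tendsto.const_mul (coeff m B)
    · have hqn := pow_nonneg hq.1.le n
      rw [Real.norm_of_nonneg (mul_nonneg (hB.nonneg hp hq m) (pow_nonneg hqn m))]
      exact hB.coeff_mul_pow_le_coeff hp hq hqn (pow_le_one₀ hq.1.le hq.2.le) m
  rwa [tsum_ite_eq] at limit

theorem tprod_mul_psEval_one (hm : Multipliable fun j : ℕ => 1 - psEval p (q ^ (j + 1))) :
    (∏' j : ℕ, (1 - psEval p (q ^ (j + 1)))) * psEval B 1 = 1 := by
  refine tendsto_nhds_unique (hm.hasProd.tendsto_prod_nat.mul_const _) ?_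
  simpa only [hB.prod_mul_psEval_one hp hq] using hB.tendsto_psEval_pow hp hq

end IsQProduct

namespace IsProbSeries

variable {p : PowerSeries ℝ} {q : ℝ} (hp : IsProbSeries p) (hq : q ∈ Set.Ioo (0 : ℝ) 1)
include hp hq

theorem psEval_pow_succ_mem_Icc (j : ℕ) : psEval p (q ^ (j + 1)) ∈ Set.Icc 0 (q ^ (j + 1)) :=
  hp.psEval_mem_Icc (pow_nonneg hq.1.le _) (pow_lt_one₀ hq.1.le hq.2 j.succ_ne_zero)

theorem summable_norm_neg_psEval_pow : Summable fun j : ℕ => ‖-psEval p (q ^ (j + 1))‖ := by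
  refine Summable.of_nonneg_of_le (fun _ => norm_nonneg _) (fun j => ?_)
    ((summable_nat_add_iff 1).2 (summable_geometric_of_lt_one hq.1.le hq.2))
  have mem := hp.psEval_pow_succ_mem_Icc hq j
  rw [norm_neg, Real.norm_of_nonneg mem.1]
  exact mem.2

theorem multipliable_one_sub_psEval : Multipliable fun j : ℕ => 1 - psEval p (q ^ (j + 1)) := by
  simpa only [sub_eq_add_neg] using
    multipliable_one_add_of_summable (hp.summable_norm_neg_psEval_pow hq)

theorem tprod_one_sub_psEval_ne_zero : ∏' j : ℕ, (1 - psEval p (q ^ (j + 1))) ≠ 0 := by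
  simp only [sub_eq_add_neg]
  refine tprod_one_add_ne_zero_of_summable (fun j => ?_) (hp.summable_norm_neg_psEval_pow hq)
  have lt_one := pow_lt_one₀ hq.1.le hq.2 j.add_one_ne_zero
  linarith [(hp.psEval_pow_succ_mem_Icc hq j).2]

end IsProbSeries

end QProductAnalysis

section LongTailed

/-- Sequences with `c_n ∼ c_{n+1}` that are eventually positive. -/
structure IsLongTailed (c : ℕ → ℝ) : Prop where
  eventually_pos : ∀ᶠ n in atTop, 0 < c n
  tendsto_div_succ : Tendsto (fun n => c n / c (n + 1)) atTop (𝓝 1)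

namespace IsLongTailed

variable {c : ℕ → ℝ} {q : ℝ} (hc : IsLongTailed c)
include hc

theorem tendsto_div_add (i : ℕ) : Tendsto (fun n => c n / c (n + i)) atTop (𝓝 1) := by
  induction i with
  | zero =>
    refine tendsto_const_nhds.congr' ?_
    filter_upwards [hc.eventually_pos] with n hn
    rw [add_zero, div_self hn.ne']
  | succ i ih =>
    have telescoped := ih.mul (hc.tendsto_div_succ.comp (tendsto_add_atTop_nat i))
    rw [mul_one] at telescoped
    refine telescoped.congr' ?_
    filter_upwards [(tendsto_add_atTop_nat i).eventually hc.eventually_pos] with n hn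
    rw [Function.comp, add_assoc, div_mul_div_cancel₀ hn.ne']

theorem exists_forall_ge_le_pow_mul {a : ℝ} (ha : 1 < a) :
    ∃ N, ∀ m ≥ N, 0 < c m ∧ ∀ n ≥ m, c m ≤ a ^ (n - m) * c n := by
  obtain ⟨N, hN⟩ := eventually_atTop.1
    (hc.eventually_pos.and (hc.tendsto_div_succ.eventually (gt_mem_nhds ha)))
  refine ⟨N, fun m hm => ⟨(hN m hm).1, fun n hmn => ?_⟩⟩
  induction n, hmn using Nat.le_induction with
  | base => simp
  | succ n hmn ih =>
    have ratio_lt := (hN n (hm.trans hmn)).2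
    rw [div_lt_iff₀ (hN (n + 1) (by omega)).1] at ratio_lt
    rw [Nat.sub_add_comm hmn, pow_succ, mul_assoc]
    exact ih.trans (mul_le_mul_of_nonneg_left ratio_lt.le (by positivity))

theorem exists_abs_le_mul_pow_mul {a : ℝ} (ha : 1 < a) :
    ∃ C, 0 ≤ C ∧ ∀ᶠ n in atTop, 0 < c n ∧ ∀ m ≤ n, |c m| ≤ C * a ^ (n - m) * c n := by
  obtain ⟨N, hN⟩ := hc.exists_forall_ge_le_pow_mul ha
  set M := ∑ i ∈ Finset.range N, |c i|
  have M_nonneg : 0 ≤ M := Finset.sum_nonneg fun i _ => abs_nonneg _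
  have cN_pos := (hN N le_rfl).1
  have hC : 0 ≤ M / c N := div_nonneg M_nonneg cN_pos.le
  refine ⟨1 + M / c N, by positivity, eventually_atTop.2 ⟨N, fun n hn =>
    ⟨(hN n hn).1, fun m hm => ?_⟩⟩⟩
  have cn_pos := (hN n hn).1
  rcases le_or_gt N m with h | h
  · rw [abs_of_pos (hN m h).1, mul_assoc]
    exact ((hN m h).2 n hm).trans (le_mul_of_one_le_left (by positivity) (by linarith))
  · calc |c m| ≤ M :=
          Finset.single_le_sum (f := fun i => |c i|) (fun i _ => abs_nonneg _)
            (Finset.mem_range.2 h)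
      _ = M / c N * c N := by field_simp
      _ ≤ M / c N * (a ^ (n - N) * c n) := by gcongr; exact (hN N le_rfl).2 n hn
      _ ≤ (1 + M / c N) * (a ^ (n - m) * c n) := by
          gcongr
          · linarith
          · exact ha.le
      _ = (1 + M / c N) * a ^ (n - m) * c n := by ring

theorem tendsto_mul_pow_div (hq : q ∈ Set.Ioo (0 : ℝ) 1) :
    Tendsto (fun n : ℕ => n * q ^ n / c n) atTop (𝓝 0) := by
  have ne : ∀ᶠ n : ℕ in atTop, (n : ℝ) * q ^ n / c n ≠ 0 := by
    filter_upwards [hc.eventually_pos, eventually_gt_atTop 0] with n hn hn₀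
    have hq₀ := hq.1
    positivity
  refine (summable_of_ratio_test_tendsto_lt_one hq.2 ne ?_).tendsto_atTop_zero
  have succ_div : Tendsto (fun n : ℕ => ((n : ℝ) + 1) / n) atTop (𝓝 1) := by
    simpa using (tendsto_natCast_div_add_atTop (1 : ℝ)).inv₀ one_ne_zero
  have limit := ((succ_div.mul_const q).mul hc.tendsto_div_succ).norm
  rw [one_mul, mul_one, Real.norm_of_nonneg hq.1.le] at limit
  refine limit.congr' ?_
  filter_upwards [hc.eventually_pos, (tendsto_add_atTop_nat 1).eventually hc.eventually_pos,
    eventually_gt_atTop 0] with n hn hn' hn₀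
  have hq₀ := hq.1.ne'
  rw [← norm_div, pow_succ]
  congr 1
  push_cast
  field_simp

/- Dominated convergence, as `c_{n-i} / c_n → 1` with `c_{n-i} / c_n ≤ C a^i` for some `a < 1/q`. -/
theorem tendsto_convolution_div (hq : q ∈ Set.Ioo (0 : ℝ) 1) {b : ℕ → ℝ} {K : ℝ}
    (hb : ∀ n, |b n| ≤ K * q ^ n) :
    Tendsto (fun n => (∑ i ∈ Finset.range (n + 1), b i * c (n - i)) / c n) atTop
      (𝓝 (∑' i, b i)) := by
  obtain ⟨a, one_lt_a, ha⟩ := exists_between (one_lt_one_div hq.1 hq.2)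
  have hq₀ := hq.1
  have q_mul_a_lt : q * a < 1 := by rwa [lt_div_iff₀' hq.1] at ha
  obtain ⟨C, hC, bound⟩ := hc.exists_abs_le_mul_pow_mul one_lt_a
  have limit : Tendsto (fun n => ∑' i, if i ≤ n then b i * (c (n - i) / c n) else 0) atTop
      (𝓝 (∑' i, b i)) := by
    refine tendsto_tsum_of_dominated_convergence (bound := fun i => (K * q ^ i) * (C * a ^ i))
      ?_ (fun i => ?_) ?_
    · simp only [mul_mul_mul_comm K, ← mul_pow]
      exact (summable_geometric_of_lt_one (by positivity) q_mul_a_lt).mul_left _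
    · have ratio : Tendsto (fun n => c (n - i) / c n) atTop (𝓝 1) := by
        rw [← tendsto_add_atTop_iff_nat i]
        simpa using hc.tendsto_div_add i
      have term := ratio.const_mul (b i)
      rw [mul_one] at term
      refine term.congr' ?_
      filter_upwards [eventually_ge_atTop i] with n hn
      rw [if_pos hn]
    · filter_upwards [bound] with n ⟨cn_pos, abs_le⟩ i
      have hK : 0 ≤ K * q ^ i := (abs_nonneg _).trans (hb i)
      split_ifs with hi
      · simp only [norm_mul, norm_div, Real.norm_eq_abs, abs_of_pos cn_pos]
        refine mul_le_mul (hb i) ?_ (by positivity) hK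
        rw [div_le_iff₀ cn_pos]
        simpa only [Nat.sub_sub_self hi] using abs_le (n - i) (Nat.sub_le _ _)
      · rw [norm_zero]
        positivity
  refine limit.congr fun n => ?_
  rw [tsum_eq_sum (s := Finset.range (n + 1)) (fun i hi => if_neg (by simpa using hi)),
    Finset.sum_div]
  refine Finset.sum_congr rfl fun i hi => ?_
  rw [if_pos (Nat.lt_succ_iff.1 (Finset.mem_range.1 hi)), mul_div_assoc]

end IsLongTailed

theorem sub_mem_Icc_of_eq_sum {b u w : ℕ → ℝ} {K K' q : ℝ} (hq : q ∈ Set.Ioo (0 : ℝ) 1)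
    (hb₀ : ∀ n, 0 ≤ b n) (hb₁ : b 0 = 1) (hb : ∀ n, b n ≤ K * q ^ n) (hu : ∀ n, 0 ≤ u n)
    (hw : ∀ n, w n ≤ K')
    (huw : ∀ n, w n = ∑ i ∈ Finset.range (n + 1), b i * q ^ (i * (n - i)) * u (n - i)) (n : ℕ) :
    w n - u n ∈ Set.Icc 0 (K * K' * (n * q ^ n)) := by
  have hq₀ := hq.1
  have difference (n : ℕ) : w n - u n = ∑ i ∈ Finset.range n,
      b (i + 1) * q ^ ((i + 1) * (n - (i + 1))) * u (n - (i + 1)) := by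
    rw [huw, Finset.sum_range_succ', hb₁, zero_mul, pow_zero, Nat.sub_zero]
    ring
  have nonneg (n : ℕ) : 0 ≤ w n - u n := by
    rw [difference]
    exact Finset.sum_nonneg fun i _ => mul_nonneg (mul_nonneg (hb₀ _) (by positivity)) (hu _)
  have u_le (n : ℕ) : u n ≤ K' := (sub_nonneg.1 (nonneg n)).trans (hw n)
  have hK' : 0 ≤ K' := (hu 0).trans (u_le 0)
  have hK : 0 ≤ K := by simpa [hb₁] using (hb₀ 0).trans (hb 0)
  refine ⟨nonneg n, ?_⟩
  rw [difference]
  calc ∑ i ∈ Finset.range n, b (i + 1) * q ^ ((i + 1) * (n - (i + 1))) * u (n - (i + 1))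
      ≤ ∑ _i ∈ Finset.range n, K * K' * q ^ n := by
        refine Finset.sum_le_sum fun i hi => ?_
        obtain ⟨j, rfl⟩ := Nat.exists_eq_add_of_lt (Finset.mem_range.1 hi)
        rw [show i + j + 1 - (i + 1) = j by omega]
        calc b (i + 1) * q ^ ((i + 1) * j) * u j
            ≤ K * q ^ (i + 1) * q ^ ((i + 1) * j) * K' :=
              mul_le_mul (mul_le_mul_of_nonneg_right (hb _) (by positivity)) (u_le _) (hu _)
                (by positivity)
          _ = K * K' * q ^ (i + 1 + (i + 1) * j) := by ring
          _ ≤ K * K' * q ^ (i + j + 1) := by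
              refine mul_le_mul_of_nonneg_left
                (pow_le_pow_of_le_one hq₀.le hq.2.le ?_) (by positivity)
              nlinarith [Nat.zero_le (i * j)]
    _ = K * K' * (n * q ^ n) := by
        rw [Finset.sum_const, Finset.card_range, nsmul_eq_mul]
        ring

theorem IsLongTailed.tendsto_div_of_sub_le {c u w : ℕ → ℝ} (hc : IsLongTailed c) {q C l : ℝ}
    (hq : q ∈ Set.Ioo (0 : ℝ) 1) (huw : ∀ n : ℕ, w n - u n ∈ Set.Icc 0 (C * (n * q ^ n)))
    (hw : Tendsto (fun n => w n / c n) atTop (𝓝 l)) :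
    Tendsto (fun n => u n / c n) atTop (𝓝 l) := by
  have error : Tendsto (fun n => (w n - u n) / c n) atTop (𝓝 0) := by
    refine squeeze_zero' ?_ ?_ (by simpa using (hc.tendsto_mul_pow_div hq).const_mul C)
    · filter_upwards [hc.eventually_pos] with n hn
      exact div_nonneg (huw n).1 hn.le
    · filter_upwards [hc.eventually_pos] with n hn
      rw [← mul_div_assoc]
      exact div_le_div_of_nonneg_right (huw n).2 hn.le
  refine (sub_zero l ▸ hw.sub error).congr fun n => ?_
  rw [← sub_div, sub_sub_cancel]

namespace IsRightInverse

variable {q : ℝ} {p g : PowerSeries ℝ}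

theorem tendsto_div (hp : IsProbSeries p) (hq : q ∈ Set.Ioo (0 : ℝ) 1)
    (h : IsRightInverse q (PowerSeries.X * (1 - p)) g) (hg : ∀ n, 0 ≤ coeff n g)
    (hc : IsLongTailed fun n => coeff n (1 - p)⁻¹) :
    Tendsto (fun n => q ^ (n + 1).choose 2 * coeff (n + 1) g / coeff n (1 - p)⁻¹) atTop
      (𝓝 (∏' j : ℕ, (1 - psEval p (q ^ (j + 1))))⁻¹) := by
  have hq₀ := hq.1
  have hB := h.isQProduct_prodSeries hp.constantCoeff_eq hq
  obtain ⟨K, coeff_le⟩ := hB.exists_coeff_le_mul_pow hp hq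
  obtain ⟨K', coeff_rescale_le⟩ := hB.exists_coeff_rescale_le hp hq
  rw [inv_eq_of_mul_eq_one_right
    (hB.tprod_mul_psEval_one hp hq (hp.multipliable_one_sub_psEval hq))]
  refine hc.tendsto_div_of_sub_le hq (sub_mem_Icc_of_eq_sum (b := fun n => coeff n (prodSeries q g))
    (u := fun n => q ^ (n + 1).choose 2 * coeff (n + 1) g)
    (w := fun n => coeff n (rescale (1 / q) (prodSeries q g))) hq (hB.nonneg hp hq) hB.coeff_zero
    coeff_le (fun n => mul_nonneg (by positivity) (hg _)) coeff_rescale_le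
    (h.coeff_rescale_prodSeries hp.constantCoeff_eq hq)) ?_
  simp only [hB.coeff_rescale_eq_sum hp, psEval, one_pow, mul_one]
  refine hc.tendsto_convolution_div (K := K) hq fun n => ?_
  rw [abs_of_nonneg (hB.nonneg hp hq n)]
  exact coeff_le n

end IsRightInverse

end LongTailed

section RegularVariation

open MeasureTheory

/-- The increment of `k` on `[x, x + s]` in absolute value, truncated at `1` so that it can be
integrated in `s` by dominated convergence. -/
noncomputable def truncDiff (k : ℝ → ℝ) (x s : ℝ) : ℝ :=
  min 1 |k (x + s) - k x|

theorem truncDiff_nonneg (k : ℝ → ℝ) (x s : ℝ) : 0 ≤ truncDiff k x s :=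
  le_min zero_le_one (abs_nonneg _)

theorem norm_truncDiff_le_one (k : ℝ → ℝ) (x s : ℝ) : ‖truncDiff k x s‖ ≤ 1 := by
  rw [Real.norm_of_nonneg (truncDiff_nonneg k x s)]
  exact min_le_left _ _

theorem truncDiff_le_add (k : ℝ → ℝ) (x u l : ℝ) :
    truncDiff k x u ≤ truncDiff k x l + truncDiff k (x + u) (l - u) := by
  have triangle : |k (x + u) - k x| ≤ |k (x + l) - k x| + |k (x + l) - k (x + u)| := by
    rw [abs_sub_comm (k (x + l)) (k (x + u)), add_comm |k (x + l) - k x|]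
    exact abs_sub_le _ _ _
  have nonneg := truncDiff_nonneg k x l
  have nonneg' := truncDiff_nonneg k (x + u) (l - u)
  unfold truncDiff at nonneg nonneg' ⊢
  rw [add_add_sub_cancel] at *
  grind

section UniformConvergence

variable {k : ℝ → ℝ} (hk : Measurable k)
include hk

theorem measurable_truncDiff (x : ℝ) : Measurable (truncDiff k x) :=
  measurable_const.min
    (measurable_abs.comp ((hk.comp (measurable_const_add x)).sub_const (k x)))

theorem intervalIntegrable_truncDiff (x a b : ℝ) :
    IntervalIntegrable (truncDiff k x) volume a b :=
  (intervalIntegrable_const (c := (1 : ℝ))).mono_fun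
    (measurable_truncDiff hk x).aestronglyMeasurable
    (Eventually.of_forall fun s => by simpa using norm_truncDiff_le_one k x s)

theorem tendsto_integral_truncDiff
    (h : ∀ s : ℝ, Tendsto (fun x => k (x + s) - k x) atTop (𝓝 0)) (a b : ℝ) :
    Tendsto (fun x => ∫ s in a..b, truncDiff k x s) atTop (𝓝 0) := by
  have pointwise (s : ℝ) : Tendsto (fun x => truncDiff k x s) atTop (𝓝 0) := by
    simpa [truncDiff] using (tendsto_const_nhds (x := (1 : ℝ))).min (h s).abs
  simpa using intervalIntegral.tendsto_integral_filter_of_dominated_convergence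
    (μ := volume) (a := a) (b := b) (fun _ => (1 : ℝ))
    (Eventually.of_forall fun x => (measurable_truncDiff hk x).aestronglyMeasurable)
    (Eventually.of_forall fun x => Eventually.of_forall fun s _ => norm_truncDiff_le_one k x s)
    intervalIntegrable_const (Eventually.of_forall fun s _ => pointwise s)

theorem truncDiff_le_integral_add (x : ℝ) {u : ℝ} (hu : u ∈ Set.Icc (0 : ℝ) 1) :
    truncDiff k x u ≤
      (∫ s in (0 : ℝ)..2, truncDiff k x s) + ∫ s in (0 : ℝ)..2, truncDiff k (x + u) s := by
  have shifted : IntervalIntegrable (fun l => truncDiff k (x + u) (l - u)) volume 1 2 := by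
    simpa using (intervalIntegrable_truncDiff hk (x + u) (1 - u) (2 - u)).comp_sub_right u
  calc truncDiff k x u = ∫ _ in (1 : ℝ)..2, truncDiff k x u := by
        rw [intervalIntegral.integral_const, smul_eq_mul]
        norm_num
    _ ≤ ∫ l in (1 : ℝ)..2, (truncDiff k x l + truncDiff k (x + u) (l - u)) :=
        intervalIntegral.integral_mono_on one_le_two intervalIntegrable_const
          ((intervalIntegrable_truncDiff hk x 1 2).add shifted)
          fun l _ => truncDiff_le_add k x u l
    _ = (∫ s in (1 : ℝ)..2, truncDiff k x s) +
          ∫ s in (1 - u)..(2 - u), truncDiff k (x + u) s := by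
        rw [intervalIntegral.integral_add (intervalIntegrable_truncDiff hk x 1 2) shifted,
          intervalIntegral.integral_comp_sub_right (truncDiff k (x + u)) u]
    _ ≤ _ := add_le_add
        (intervalIntegral.integral_mono_interval zero_le_one one_le_two le_rfl
          (Eventually.of_forall (truncDiff_nonneg k x)) (intervalIntegrable_truncDiff hk x 0 2))
        (intervalIntegral.integral_mono_interval (by linarith [hu.2]) (by linarith)
          (by linarith [hu.1]) (Eventually.of_forall (truncDiff_nonneg k (x + u)))
          (intervalIntegrable_truncDiff hk (x + u) 0 2))

/-- The uniform convergence theorem for slowly varying functions, in additive form. -/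
theorem exists_forall_abs_sub_le
    (h : ∀ s : ℝ, Tendsto (fun x => k (x + s) - k x) atTop (𝓝 0)) {ε : ℝ} (hε : 0 < ε) :
    ∃ X, ∀ x ≥ X, ∀ u ∈ Set.Icc (0 : ℝ) 1, |k (x + u) - k x| ≤ ε := by
  have small_pos : 0 < min ε 1 := lt_min hε one_pos
  obtain ⟨X, hX⟩ := eventually_atTop.1
    ((tendsto_integral_truncDiff hk h 0 2).eventually (gt_mem_nhds (half_pos small_pos)))
  refine ⟨X, fun x hx u hu => ?_⟩
  have truncDiff_lt : truncDiff k x u < min ε 1 := by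
    linarith [truncDiff_le_integral_add hk x hu, hX x hx, hX (x + u) (by linarith [hu.1])]
  rcases min_lt_iff.1 truncDiff_lt with one_lt | abs_lt
  · exact absurd (min_le_right ε 1) one_lt.not_ge
  · exact abs_lt.le.trans (min_le_left _ _)

end UniformConvergence

theorem abs_sub_le_mul_one_add {k : ℝ → ℝ} {ε X : ℝ}
    (h : ∀ x ≥ X, ∀ u ∈ Set.Icc (0 : ℝ) 1, |k (x + u) - k x| ≤ ε)
    {x : ℝ} (hx : X ≤ x) {u : ℝ} (hu : 0 ≤ u) : |k (x + u) - k x| ≤ ε * (1 + u) := by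
  have hε : 0 ≤ ε := (abs_nonneg _).trans (h x hx 0 (by simp))
  have key (n : ℕ) : ∀ v ∈ Set.Icc (0 : ℝ) 1, |k (x + (n + v)) - k x| ≤ ε * (1 + n) := by
    induction n with
    | zero => intro v hv; simpa using h x hx v hv
    | succ n ih =>
      intro v hv
      have last_step := h (x + (n + 1)) (by linarith [Nat.cast_nonneg (α := ℝ) n]) v hv
      have first_steps := ih 1 (by simp)
      have triangle := abs_sub_le (k (x + (n + 1) + v)) (k (x + (n + 1))) (k x)
      push_cast
      rw [← add_assoc x]
      linarith
  have bound := key ⌊u⌋₊ (u - ⌊u⌋₊)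
    ⟨by linarith [Nat.floor_le hu], by linarith [Nat.lt_floor_add_one u]⟩
  rw [add_sub_cancel] at bound
  exact bound.trans (by gcongr; exact Nat.floor_le hu)

namespace RegularlyVaryingSeq

variable {c : ℕ → ℝ} {σ ε : ℝ} (h : RegularlyVaryingSeq c σ) (hc : ∀ n, 0 ≤ c n)
include h hc

theorem eventually_pos : ∀ᶠ n in atTop, 0 < c n := by
  have ratio := (h 1 one_pos).comp (tendsto_natCast_atTop_atTop (R := ℝ))
  rw [Real.one_rpow] at ratio
  filter_upwards [ratio.eventually (lt_mem_nhds one_half_lt_one)] with n hn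
  simp only [Function.comp, Nat.floor_natCast, one_mul] at hn
  refine (hc n).lt_of_ne fun eq_zero => ?_
  rw [← eq_zero] at hn
  norm_num at hn

theorem tendsto_log_sub (s : ℝ) :
    Tendsto (fun x => (Real.log (c ⌊Real.exp (x + s)⌋₊) - σ * (x + s)) -
      (Real.log (c ⌊Real.exp x⌋₊) - σ * x)) atTop (𝓝 0) := by
  have log_ratio := ((h (Real.exp s) (Real.exp_pos s)).comp Real.tendsto_exp_atTop).log
    (Real.rpow_pos_of_pos (Real.exp_pos s) σ).ne'
  rw [← Real.exp_mul, Real.log_exp] at log_ratio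
  refine (sub_self (s * σ) ▸ log_ratio.sub_const (s * σ)).congr' ?_
  have floor_tendsto : Tendsto (fun x : ℝ => ⌊Real.exp x⌋₊) atTop atTop :=
    tendsto_nat_floor_atTop.comp Real.tendsto_exp_atTop
  have pos := floor_tendsto.eventually (h.eventually_pos hc)
  filter_upwards [pos, (tendsto_atTop_add_const_right _ s tendsto_id).eventually pos]
    with x hx hx'
  simp only [Function.comp, id] at hx' ⊢
  rw [← Real.exp_add, add_comm s x, Real.log_div hx'.ne' hx.ne']
  ring

theorem exists_abs_log_sub_le (hε : 0 < ε) :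
    ∃ N ≥ 1, ∀ m ≥ N, 0 < c m ∧ ∀ n ≥ m,
      |(Real.log (c n) - σ * Real.log n) - (Real.log (c m) - σ * Real.log m)| ≤
        ε * (1 + (Real.log n - Real.log m)) := by
  have measurable : Measurable fun x : ℝ => Real.log (c ⌊Real.exp x⌋₊) - σ * x :=
    (Real.measurable_log.comp ((measurable_from_top (f := c)).comp
      (Nat.measurable_floor.comp Real.measurable_exp))).sub (measurable_id.const_mul σ)
  obtain ⟨X, hX⟩ := exists_forall_abs_sub_le measurable (h.tendsto_log_sub hc) hε
  obtain ⟨N, hN⟩ := eventually_atTop.1 ((h.eventually_pos hc).and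
    ((eventually_ge_atTop 1).and ((Real.tendsto_log_atTop.comp
      (tendsto_natCast_atTop_atTop (R := ℝ))).eventually (eventually_ge_atTop X))))
  refine ⟨N, (hN N le_rfl).2.1, fun m hm => ⟨(hN m hm).1, fun n hn => ?_⟩⟩
  have m_pos : (0 : ℝ) < m := Nat.cast_pos.2 (hN m hm).2.1
  have m_le_n : (m : ℝ) ≤ n := Nat.cast_le.2 hn
  have bound := abs_sub_le_mul_one_add (k := fun x => Real.log (c ⌊Real.exp x⌋₊) - σ * x) hX
    (hN m hm).2.2 (u := Real.log n - Real.log m)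
    (sub_nonneg.2 (Real.log_le_log m_pos m_le_n))
  simpa [Real.exp_log m_pos, Real.exp_log (m_pos.trans_le m_le_n)] using bound

/-- Potter's bounds. -/
theorem exists_div_le_rpow (hε : 0 < ε) :
    ∃ N ≥ 1, ∀ m ≥ N, 0 < c m ∧ ∀ n ≥ m,
      c n / c m ≤ Real.exp ε * ((n : ℝ) / m) ^ (σ + ε) ∧
      c m / c n ≤ Real.exp ε * ((m : ℝ) / n) ^ (σ - ε) := by
  obtain ⟨N, hN₁, hN⟩ := h.exists_abs_log_sub_le hc hε
  refine ⟨N, hN₁, fun m hm => ⟨(hN m hm).1, fun n hn => ?_⟩⟩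
  have m_pos : (0 : ℝ) < m := Nat.cast_pos.2 (by omega)
  have n_pos : (0 : ℝ) < n := Nat.cast_pos.2 (by omega)
  have cm_pos := (hN m hm).1
  have cn_pos := (hN n (by omega)).1
  have log_bound := abs_le.1 ((hN m hm).2 n hn)
  rw [Real.rpow_def_of_pos (div_pos n_pos m_pos), Real.rpow_def_of_pos (div_pos m_pos n_pos),
    ← Real.exp_add, ← Real.exp_add, ← Real.exp_log (div_pos cn_pos cm_pos),
    ← Real.exp_log (div_pos cm_pos cn_pos), Real.exp_le_exp, Real.exp_le_exp,
    Real.log_div cn_pos.ne' cm_pos.ne', Real.log_div cm_pos.ne' cn_pos.ne',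
    Real.log_div n_pos.ne' m_pos.ne', Real.log_div m_pos.ne' n_pos.ne']
  constructor <;> nlinarith [log_bound.1, log_bound.2]

theorem isLongTailed : IsLongTailed c where
  eventually_pos := h.eventually_pos hc
  tendsto_div_succ := by
    have increments : Tendsto (fun n : ℕ => (Real.log (c (n + 1)) - σ * Real.log (n + 1 : ℕ)) -
        (Real.log (c n) - σ * Real.log n)) atTop (𝓝 0) := by
      rw [Metric.tendsto_nhds]
      intro ε hε
      obtain ⟨N, -, hN⟩ := h.exists_abs_log_sub_le hc (ε := ε / 4) (by positivity)
      filter_upwards [eventually_ge_atTop N,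
        Real.tendsto_log_nat_add_one_sub_log.eventually (gt_mem_nhds one_pos)] with n hn log_lt
      rw [Real.dist_eq, sub_zero]
      refine ((hN n hn).2 (n + 1) (by omega)).trans_lt ?_
      push_cast
      nlinarith
    have limit := (Real.continuous_exp.tendsto _).comp
      (increments.add (Real.tendsto_log_nat_add_one_sub_log.const_mul σ)).neg
    rw [mul_zero, add_zero, neg_zero, Real.exp_zero] at limit
    refine limit.congr' ?_
    have pos := h.eventually_pos hc
    filter_upwards [pos, (tendsto_add_atTop_nat 1).eventually pos] with n hn hn'
    rw [← Real.exp_log (div_pos hn hn'), Real.log_div hn.ne' hn'.ne', Function.comp]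
    push_cast
    ring_nf

theorem exists_forall_le_div_le (hε : 0 < ε) (hσ : σ ≤ ε) :
    ∃ C, 0 ≤ C ∧ ∀ᶠ N : ℕ in atTop, ∀ m ≤ N, c m / c N ≤ C * ((m + 1 : ℝ) / N) ^ (σ - ε) := by
  obtain ⟨N₀, hN₀, hN⟩ := h.exists_div_le_rpow hc hε
  have cN₀_pos := (hN N₀ le_rfl).1
  set M := 1 + ∑ i ∈ Finset.range N₀, c i / c N₀
  have sum_nonneg : 0 ≤ ∑ i ∈ Finset.range N₀, c i / c N₀ :=
    Finset.sum_nonneg fun i _ => div_nonneg (hc i) cN₀_pos.le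
  have hM : 0 ≤ M := add_nonneg zero_le_one sum_nonneg
  have le_max (m : ℕ) : c m ≤ M * c (max m N₀) := by
    rcases le_or_gt N₀ m with hm | hm
    · rw [max_eq_left hm]
      exact le_mul_of_one_le_left (hc m) (le_add_of_nonneg_right sum_nonneg)
    · rw [max_eq_right hm.le, ← div_le_iff₀ cN₀_pos]
      refine (Finset.single_le_sum (f := fun i => c i / c N₀)
        (fun i _ => div_nonneg (hc i) cN₀_pos.le) (Finset.mem_range.2 hm)).trans ?_
      exact le_add_of_nonneg_left zero_le_one
  refine ⟨M * Real.exp ε * (1 / 2) ^ (σ - ε), by positivity,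
    eventually_atTop.2 ⟨N₀, fun N hNN₀ m hmN => ?_⟩⟩
  have N_pos : (0 : ℝ) < N := Nat.cast_pos.2 (by omega)
  have half_le : 1 / 2 * ((m + 1 : ℝ) / N) ≤ (max m N₀ : ℕ) / N := by
    rw [← mul_div_assoc]
    gcongr
    have : (m + 1 : ℝ) ≤ 2 * (max m N₀ : ℕ) := by exact_mod_cast (by omega)
    linarith
  calc c m / c N ≤ M * (c (max m N₀) / c N) := by
        rw [← mul_div_assoc]
        exact div_le_div_of_nonneg_right (le_max m) (hc N)
    _ ≤ M * (Real.exp ε * ((max m N₀ : ℕ) / N : ℝ) ^ (σ - ε)) :=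
        mul_le_mul_of_nonneg_left
          ((hN _ (le_max_right m N₀)).2 N (max_le hmN hNN₀)).2 hM
    _ ≤ M * (Real.exp ε * (1 / 2 * ((m + 1 : ℝ) / N)) ^ (σ - ε)) := by
        gcongr M * (Real.exp ε * ?_)
        exact Real.rpow_le_rpow_of_nonpos (by positivity) half_le (by linarith)
    _ = M * Real.exp ε * (1 / 2) ^ (σ - ε) * ((m + 1 : ℝ) / N) ^ (σ - ε) := by
        rw [Real.mul_rpow (by norm_num) (by positivity)]
        ring

theorem exists_div_le (hε : 0 < ε) (hσ : σ ≤ ε) (hσ' : σ + ε ≤ 1) :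
    ∃ C, 0 ≤ C ∧ ∀ᶠ N : ℕ in atTop, ∀ m : ℕ,
      c m / c N ≤ C * (((m + 1 : ℝ) / N) ^ (σ - ε) + m / N) := by
  obtain ⟨C, hC, forall_le⟩ := h.exists_forall_le_div_le hc hε hσ
  obtain ⟨N₀, hN₀, hN⟩ := h.exists_div_le_rpow hc hε
  refine ⟨C + Real.exp ε, by positivity, ?_⟩
  filter_upwards [forall_le, eventually_ge_atTop N₀] with N hCN hNN₀ m
  have N_pos : (0 : ℝ) < N := Nat.cast_pos.2 (by omega)
  have small_nonneg : 0 ≤ ((m + 1 : ℝ) / N) ^ (σ - ε) := by positivity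
  have large_nonneg : 0 ≤ (m : ℝ) / N := by positivity
  rcases le_total m N with hmN | hmN
  · refine (hCN m hmN).trans (mul_le_mul ?_ ?_ small_nonneg (by positivity))
    · linarith [Real.exp_pos ε]
    · linarith
  · have one_le : 1 ≤ (m : ℝ) / N := (one_le_div N_pos).2 (by exact_mod_cast hmN)
    calc c m / c N ≤ Real.exp ε * ((m : ℝ) / N) ^ (σ + ε) := ((hN N hNN₀).2 m hmN).1
      _ ≤ Real.exp ε * ((m : ℝ) / N) ^ (1 : ℝ) := by gcongr
      _ ≤ (C + Real.exp ε) * (((m + 1 : ℝ) / N) ^ (σ - ε) + m / N) := by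
        rw [Real.rpow_one]
        gcongr <;> linarith

end RegularlyVaryingSeq

end RegularVariation

section AbelianTheorem

open MeasureTheory

theorem hasSum_setIntegral_floor {f : ℕ → ℝ}
    (hf : IntegrableOn (fun x : ℝ => f ⌊x⌋₊) (Set.Ioi 0)) :
    HasSum f (∫ x in Set.Ioi (0 : ℝ), f ⌊x⌋₊) := by
  have cover : ⋃ n : ℕ, Set.Ico (n : ℝ) (n + 1 : ℕ) = Set.Ici 0 := by
    ext x
    simp only [Set.mem_iUnion, Set.mem_Ico, Set.mem_Ici, Nat.cast_add_one]
    exact ⟨fun ⟨n, hn⟩ => (Nat.cast_nonneg n).trans hn.1,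
      fun hx => ⟨⌊x⌋₊, Nat.floor_le hx, Nat.lt_floor_add_one x⟩⟩
  have hasSum := hasSum_integral_iUnion (μ := volume) (f := fun x : ℝ => f ⌊x⌋₊)
    (fun n : ℕ => measurableSet_Ico) Nat.mono_cast.pairwise_disjoint_on_Ico_succ
    (by
      simp only [Nat.succ_eq_succ, Nat.succ_eq_add_one, cover]
      exact (integrableOn_Ici_iff_integrableOn_Ioi).2 hf)
  simp only [Nat.succ_eq_succ, Nat.succ_eq_add_one, cover,
    integral_Ici_eq_integral_Ioi] at hasSum
  refine hasSum.congr_fun fun n => ?_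
  rw [setIntegral_congr_fun measurableSet_Ico (g := fun _ => f n) fun x hx => ?_,
    setIntegral_const]
  · simp
  · have floor_eq : ⌊x⌋₊ = n :=
      (Nat.floor_eq_iff ((Nat.cast_nonneg n).trans hx.1)).2 (by exact_mod_cast hx)
    simp only [floor_eq]

theorem measurable_comp_floor_mul (F : ℕ → ℝ) (a : ℝ) : Measurable fun x : ℝ => F ⌊x * a⌋₊ :=
  (measurable_from_top (f := F)).comp (Nat.measurable_floor.comp (measurable_id.mul_const a))

theorem tsum_div_eq_integral {F : ℕ → ℝ} {a : ℝ} (ha : 0 < a)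
    (hF : IntegrableOn (fun x : ℝ => F ⌊x * a⌋₊) (Set.Ioi 0)) :
    (∑' n, F n) / a = ∫ x in Set.Ioi (0 : ℝ), F ⌊x * a⌋₊ := by
  rw [integrableOn_Ioi_comp_mul_right_iff (fun y : ℝ => F ⌊y⌋₊) 0 ha, zero_mul] at hF
  rw [integral_comp_mul_right_Ioi (fun y : ℝ => F ⌊y⌋₊) 0 ha, zero_mul,
    (hasSum_setIntegral_floor hF).tsum_eq, smul_eq_mul, div_eq_inv_mul]

theorem one_sub_one_div_natCast_nonneg (N : ℕ) : 0 ≤ 1 - 1 / (N : ℝ) := by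
  rw [sub_nonneg, one_div]
  exact Nat.cast_inv_le_one N

theorem tendsto_one_sub_pow_floor {x : ℝ} (hx : 0 ≤ x) :
    Tendsto (fun N : ℕ => (1 - 1 / (N : ℝ)) ^ ⌊x * N⌋₊) atTop (𝓝 (Real.exp (-x))) := by
  have base := Real.tendsto_one_add_div_pow_exp (-1)
  have exponent := (tendsto_nat_floor_mul_div_atTop (R := ℝ) hx).comp tendsto_natCast_atTop_atTop
  have limit := base.rpow exponent (Or.inl (Real.exp_pos _).ne')
  rw [← Real.exp_mul, neg_one_mul] at limit
  refine limit.congr' ?_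
  filter_upwards [eventually_gt_atTop 0] with N hN
  have N_ne : (N : ℝ) ≠ 0 := Nat.cast_ne_zero.2 hN.ne'
  simp only [Function.comp, neg_div, ← sub_eq_add_neg]
  rw [← Real.rpow_natCast_mul (one_sub_one_div_natCast_nonneg N), mul_div_cancel₀ _ N_ne,
    Real.rpow_natCast]

theorem one_sub_pow_floor_le (x : ℝ) {N : ℕ} (hN : 1 ≤ N) :
    (1 - 1 / (N : ℝ)) ^ ⌊x * N⌋₊ ≤ Real.exp 1 * Real.exp (-x) := by
  have one_le_N : (1 : ℝ) ≤ N := by exact_mod_cast hN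
  have N_pos : (0 : ℝ) < N := by positivity
  calc (1 - 1 / (N : ℝ)) ^ ⌊x * N⌋₊ ≤ Real.exp (-(1 / (N : ℝ))) ^ ⌊x * N⌋₊ :=
        pow_le_pow_left₀ (one_sub_one_div_natCast_nonneg N) (Real.one_sub_le_exp_neg _) _
    _ = Real.exp (-(⌊x * N⌋₊ / (N : ℝ))) := by
        rw [← Real.exp_nat_mul]
        ring_nf
    _ ≤ Real.exp (1 - x) := by
        rw [Real.exp_le_exp]
        have x_le : x ≤ (⌊x * N⌋₊ + 1 : ℝ) / N :=
          (le_div_iff₀ N_pos).2 (Nat.lt_floor_add_one _).le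
        rw [add_div] at x_le
        linarith [(div_le_one N_pos).2 one_le_N]
    _ = Real.exp 1 * Real.exp (-x) := by rw [← Real.exp_add, sub_eq_add_neg]

namespace RegularlyVaryingSeq

variable {c : ℕ → ℝ} {ρ : ℝ} (h : RegularlyVaryingSeq c (ρ - 1))
  (hρ : ρ - 1 ∈ Set.Ioc (-1 : ℝ) 0) (hc : ∀ n, 0 ≤ c n)
include h hρ hc

theorem exists_integrable_bound :
    ∃ bound : ℝ → ℝ, IntegrableOn bound (Set.Ioi 0) ∧ ∀ᶠ N : ℕ in atTop, ∀ x ∈ Set.Ioi (0 : ℝ),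
      ‖c ⌊x * N⌋₊ / c N * (1 - 1 / (N : ℝ)) ^ ⌊x * N⌋₊‖ ≤ bound x := by
  have hρ₀ : 0 < ρ := by linarith [hρ.1]
  obtain ⟨C, hC, div_le⟩ := h.exists_div_le hc (half_pos hρ₀) (by linarith [hρ.2])
    (by linarith [hρ.2])
  refine ⟨fun x => C * Real.exp 1 *
      (Real.exp (-x) * x ^ (ρ / 2 - 1) + Real.exp (-x) * x ^ ((2 : ℝ) - 1)),
    ((Real.GammaIntegral_convergent (half_pos hρ₀)).add
      (Real.GammaIntegral_convergent two_pos)).const_mul _, ?_⟩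
  filter_upwards [div_le, eventually_ge_atTop 1] with N hCN hN x hx
  have x_pos : 0 < x := hx
  have N_pos : (0 : ℝ) < N := Nat.cast_pos.2 hN
  have base_nonneg := one_sub_one_div_natCast_nonneg N
  rw [Real.norm_of_nonneg (mul_nonneg (div_nonneg (hc _) (hc _)) (pow_nonneg base_nonneg _))]
  have ratio_le : c ⌊x * N⌋₊ / c N ≤ C * (x ^ (ρ / 2 - 1) + x ^ ((2 : ℝ) - 1)) := by
    refine (hCN _).trans (mul_le_mul_of_nonneg_left (add_le_add ?_ ?_) hC)
    · rw [show ρ - 1 - ρ / 2 = ρ / 2 - 1 by ring]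
      exact Real.rpow_le_rpow_of_nonpos x_pos
        ((le_div_iff₀ N_pos).2 (Nat.lt_floor_add_one _).le) (by linarith [hρ.2])
    · rw [show (2 : ℝ) - 1 = 1 by norm_num, Real.rpow_one, div_le_iff₀ N_pos]
      exact Nat.floor_le (by positivity)
  calc c ⌊x * N⌋₊ / c N * (1 - 1 / (N : ℝ)) ^ ⌊x * N⌋₊
      ≤ C * (x ^ (ρ / 2 - 1) + x ^ ((2 : ℝ) - 1)) * (Real.exp 1 * Real.exp (-x)) :=
        mul_le_mul ratio_le (one_sub_pow_floor_le x hN) (pow_nonneg base_nonneg _)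
          (by positivity)
    _ = _ := by ring

theorem tendsto_integral_Gamma :
    Tendsto (fun N : ℕ => ∫ x in Set.Ioi (0 : ℝ),
      c ⌊x * N⌋₊ / c N * (1 - 1 / (N : ℝ)) ^ ⌊x * N⌋₊) atTop (𝓝 (Real.Gamma ρ)) := by
  obtain ⟨bound, integrable, le_bound⟩ := h.exists_integrable_bound hρ hc
  rw [Real.Gamma_eq_integral (by linarith [hρ.1])]
  refine tendsto_integral_filter_of_dominated_convergence bound
    (Eventually.of_forall fun N => (measurable_comp_floor_mul
      (fun m => c m / c N * (1 - 1 / (N : ℝ)) ^ m) N).aestronglyMeasurable) ?_ integrable ?_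
  · filter_upwards [le_bound] with N hN
    exact (ae_restrict_iff' measurableSet_Ioi).2 (Eventually.of_forall hN)
  · refine (ae_restrict_iff' measurableSet_Ioi).2 (Eventually.of_forall fun x hx => ?_)
    have ratio := (h x hx).comp (tendsto_natCast_atTop_atTop (R := ℝ))
    simp only [Function.comp_def, Nat.floor_natCast] at ratio
    simpa only [mul_comm (Real.exp (-x))] using ratio.mul (tendsto_one_sub_pow_floor (le_of_lt hx))

/-- The Abelian theorem of Karamata, along the radii `1 - 1 / N`. -/
theorem tendsto_tsum_div :
    Tendsto (fun N : ℕ => (∑' n, c n * (1 - 1 / (N : ℝ)) ^ n) / (N * c N)) atTop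
      (𝓝 (Real.Gamma ρ)) := by
  obtain ⟨bound, integrable, le_bound⟩ := h.exists_integrable_bound hρ hc
  refine (h.tendsto_integral_Gamma hρ hc).congr' ?_
  filter_upwards [le_bound, eventually_ge_atTop 1] with N hN one_le_N
  have N_pos : (0 : ℝ) < N := Nat.cast_pos.2 one_le_N
  rw [← tsum_div_eq_integral (F := fun m => c m / c N * (1 - 1 / (N : ℝ)) ^ m) N_pos
    (integrable.mono' (measurable_comp_floor_mul
      (fun m => c m / c N * (1 - 1 / (N : ℝ)) ^ m) N).aestronglyMeasurable
      ((ae_restrict_iff' measurableSet_Ioi).2 (Eventually.of_forall hN))),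
    mul_comm (N : ℝ), ← div_div]
  congr 1
  simp only [div_mul_eq_mul_div, tsum_div_const]

end RegularlyVaryingSeq

end AbelianTheorem

section PowerSeriesLimits

theorem eq_zero_of_forall_hasSum_zero {s : PowerSeries ℝ}
    (hs : ∀ x ∈ Set.Ioo (0 : ℝ) 1, HasSum (fun j => coeff j s * x ^ j) 0) : s = 0 := by
  set F := FormalMultilinearSeries.ofScalars ℝ fun j => coeff j s with hF
  have sum_eq_zero {x : ℝ} (hx : x ∈ Set.Ioo (0 : ℝ) 1) : F.sum x = 0 :=
    (FormalMultilinearSeries.ofScalars_sum_eq _ x).trans (hs x hx).tsum_eq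
  have radius_pos : 0 < F.radius := by
    have half_mem : ((1 / 2 : NNReal) : ℝ) ∈ Set.Ioo (0 : ℝ) 1 := by norm_num
    refine lt_of_lt_of_le ?_ (F.le_radius_of_summable_norm (r := 1 / 2) ?_)
    · simp
    · simpa only [hF, FormalMultilinearSeries.ofScalars_norm, norm_mul, norm_pow,
        NNReal.norm_eq] using (hs _ half_mem).summable.norm
  have expansion := (F.hasFPowerSeriesOnBall radius_pos).hasFPowerSeriesAt
  have vanishes_right : ∀ᶠ x in 𝓝[>] (0 : ℝ), F.sum x = 0 := by
    filter_upwards [Ioo_mem_nhdsGT one_pos] with x hx using sum_eq_zero hx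
  have F_eq_zero : F = 0 := expansion.locally_zero_iff.1
    (expansion.analyticAt.frequently_zero_iff_eventually_zero.1
      (vanishes_right.frequently.filter_mono (nhdsGT_le_nhdsNE 0)))
  ext j
  exact congrFun ((FormalMultilinearSeries.ofScalars_series_eq_zero ℝ).1 F_eq_zero) j

theorem ext_of_forall_hasSum {s t : PowerSeries ℝ} {l : ℝ → ℝ}
    (hs : ∀ x ∈ Set.Ioo (0 : ℝ) 1, HasSum (fun j => coeff j s * x ^ j) (l x))
    (ht : ∀ x ∈ Set.Ioo (0 : ℝ) 1, HasSum (fun j => coeff j t * x ^ j) (l x)) : s = t :=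
  sub_eq_zero.1 <| eq_zero_of_forall_hasSum_zero fun x hx => by
    simpa only [map_sub, sub_mul, sub_self] using (hs x hx).sub (ht x hx)

theorem hasSum_coeff_mul_pow (P : Polynomial ℝ) (x : ℝ) :
    HasSum (fun j => P.coeff j * x ^ j) (P.eval x) := by
  rw [Polynomial.eval_eq_sum_range]
  refine hasSum_sum_of_ne_finset_zero fun j hj => ?_
  rw [Polynomial.coeff_eq_zero_of_natDegree_lt (by simpa using hj), zero_mul]

theorem coeff_le_eval_div {P : Polynomial ℝ} (hP : ∀ j, 0 ≤ P.coeff j) {x : ℝ} (hx : 0 < x)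
    (j : ℕ) : P.coeff j ≤ P.eval x / x ^ j :=
  (le_div_iff₀ (pow_pos hx j)).2 <| le_hasSum (hasSum_coeff_mul_pow P x) j
    fun i _ => mul_nonneg (hP i) (pow_nonneg hx.le i)

variable {ι : Type*} {a : ι → Polynomial ℝ} (ha : ∀ i j, 0 ≤ (a i).coeff j)
include ha

theorem eventually_forall_coeff_le {𝓕 : Filter ι} {x l : ℝ} (hx : 0 < x)
    (h : Tendsto (fun i => (a i).eval x) 𝓕 (𝓝 l)) :
    ∀ᶠ i in 𝓕, ∀ j, (a i).coeff j ≤ (l + 1) / x ^ j := by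
  filter_upwards [h.eventually (gt_mem_nhds (lt_add_one l))] with i hi j
  exact (coeff_le_eval_div (ha i) hx j).trans
    (div_le_div_of_nonneg_right hi.le (pow_nonneg hx.le j))

theorem hasSum_of_tendsto_coeff {𝓕 : Filter ι} [𝓕.NeBot] {y : ℕ → ℝ} {x z lx lz : ℝ}
    (hx : 0 < x) (hxz : x < z) (hlx : Tendsto (fun i => (a i).eval x) 𝓕 (𝓝 lx))
    (hlz : Tendsto (fun i => (a i).eval z) 𝓕 (𝓝 lz))
    (hy : ∀ j, Tendsto (fun i => (a i).coeff j) 𝓕 (𝓝 (y j))) :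
    HasSum (fun j => y j * x ^ j) lx := by
  have hz : 0 < z := hx.trans hxz
  have bound_summable : Summable fun j : ℕ => (lz + 1) * (x / z) ^ j :=
    (summable_geometric_of_lt_one (by positivity) ((div_lt_one hz).2 hxz)).mul_left _
  have le_bound : ∀ᶠ i in 𝓕, ∀ j, ‖(a i).coeff j * x ^ j‖ ≤ (lz + 1) * (x / z) ^ j := by
    filter_upwards [eventually_forall_coeff_le ha hz hlz] with i hi j
    rw [Real.norm_of_nonneg (mul_nonneg (ha i j) (by positivity)), div_pow, ← mul_div_assoc,
      mul_div_right_comm]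
    exact mul_le_mul_of_nonneg_right (hi j) (by positivity)
  have limit := tendsto_tsum_of_dominated_convergence bound_summable
    (fun j => (hy j).mul_const (x ^ j)) le_bound
  simp only [(hasSum_coeff_mul_pow _ x).tsum_eq] at limit
  rw [tendsto_nhds_unique hlx limit]
  exact (bound_summable.of_norm_bounded fun j =>
    le_of_tendsto ((hy j).mul_const (x ^ j)).norm (le_bound.mono fun i hi => hi j)).hasSum

theorem exists_tendsto_coeff_ultrafilter {U : Ultrafilter ι} {x l : ℝ} (hx : 0 < x)
    (h : Tendsto (fun i => (a i).eval x) U (𝓝 l)) (j : ℕ) :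
    ∃ y, Tendsto (fun i => (a i).coeff j) U (𝓝 y) := by
  have bounded : ∀ᶠ i in (U : Filter ι), (a i).coeff j ∈ Set.Icc (0 : ℝ) ((l + 1) / x ^ j) := by
    filter_upwards [eventually_forall_coeff_le ha hx h] with i hi using ⟨ha i j, hi j⟩
  obtain ⟨y, -, hy⟩ := isCompact_Icc.ultrafilter_le_nhds (U.map fun i => (a i).coeff j)
    (le_principal_iff.2 bounded)
  exact ⟨y, hy⟩

theorem exists_powerSeries_of_tendsto_ultrafilter {U : Ultrafilter ι} {l : ℝ → ℝ}
    (h : ∀ x ∈ Set.Ioo (0 : ℝ) 1, Tendsto (fun i => (a i).eval x) U (𝓝 (l x))) :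
    ∃ L : PowerSeries ℝ, (∀ x ∈ Set.Ioo (0 : ℝ) 1, HasSum (fun j => coeff j L * x ^ j) (l x)) ∧
      ∀ j, Tendsto (fun i => (a i).coeff j) U (𝓝 (coeff j L)) := by
  choose y hy using
    exists_tendsto_coeff_ultrafilter ha one_half_pos (h (1 / 2) (by norm_num))
  refine ⟨PowerSeries.mk y, fun x hx => ?_,
    fun j => by simpa only [PowerSeries.coeff_mk] using hy j⟩
  obtain ⟨z, hxz, hz⟩ := exists_between hx.2
  simpa only [PowerSeries.coeff_mk] using
    hasSum_of_tendsto_coeff ha hx.1 hxz (h x hx) (h z ⟨hx.1.trans hxz, hz⟩) hy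

/- Every ultrafilter limit of the coefficients is the power series of `l`, hence the same. -/
theorem exists_powerSeries_of_tendsto_eval {𝓕 : Filter ι} [𝓕.NeBot] {l : ℝ → ℝ}
    (h : ∀ x ∈ Set.Ioo (0 : ℝ) 1, Tendsto (fun i => (a i).eval x) 𝓕 (𝓝 (l x))) :
    ∃ L : PowerSeries ℝ, (∀ x ∈ Set.Ioo (0 : ℝ) 1, HasSum (fun j => coeff j L * x ^ j) (l x)) ∧
      ∀ j, Tendsto (fun i => (a i).coeff j) 𝓕 (𝓝 (coeff j L)) := by
  obtain ⟨L, hL, -⟩ := exists_powerSeries_of_tendsto_ultrafilter ha (U := Ultrafilter.of 𝓕)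
    fun x hx => (h x hx).mono_left (Ultrafilter.of_le 𝓕)
  refine ⟨L, hL, fun j => (tendsto_iff_ultrafilter _ _ _).2 fun U hU => ?_⟩
  obtain ⟨L', hL', coeff_tendsto⟩ := exists_powerSeries_of_tendsto_ultrafilter ha (U := U)
    fun x hx => (h x hx).mono_left hU
  rw [ext_of_forall_hasSum hL hL']
  exact coeff_tendsto j

end PowerSeriesLimits

section ModesOfConvergence

variable {a : ℕ → Polynomial ℝ} {L : PowerSeries ℝ} {A : Set ℝ}
  (h : ∀ q ∈ A, Tendsto (fun n => (a n).eval q) atTop (𝓝 (psEval L q)))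
include h

theorem convergesLiminf_of_tendsto : ConvergesLiminf a L A := fun q hq =>
  ((continuous_coe_real_ereal.tendsto _).comp (h q hq)).liminf_eq

theorem convergesOffDensityZero_of_tendsto : ConvergesOffDensityZero a L A := by
  classical
  intro δ hδ q hq
  set far : ℕ → ℝ := fun i => if δ ≤ |(a i).eval q - psEval L q| then 1 else 0
  have far_tendsto : Tendsto far atTop (𝓝 0) := by
    refine tendsto_const_nhds.congr' ?_
    filter_upwards [Metric.tendsto_nhds.1 (h q hq) δ hδ] with i hi
    exact (if_neg (not_le.2 hi)).symm
  refine ((tendsto_add_atTop_iff_nat 1).2 far_tendsto).cesaro.congr fun n => ?_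
  rw [one_div, sum_Icc_one far]

end ModesOfConvergence

section Renewal

/-- The value at `z` of the real power series `p` at a complex argument, meant where the series
converges; the counterpart of `psEval`. -/
noncomputable def cpsEval (p : PowerSeries ℝ) (z : ℂ) : ℂ :=
  ∑' n : ℕ, ((coeff n p : ℝ) : ℂ) * z ^ n

theorem cpsEval_ofReal (p : PowerSeries ℝ) (x : ℝ) : cpsEval p x = (psEval p x : ℝ) := by
  rw [cpsEval, psEval, Complex.ofReal_tsum]
  exact tsum_congr fun n => by push_cast; rfl

section Differentiability

variable {p : PowerSeries ℝ} {R : ℝ} (hs : Summable fun n => coeff n p * R ^ n)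
include hs

theorem differentiableOn_cpsEval : DifferentiableOn ℂ (cpsEval p) (Metric.ball 0 R) := by
  refine Complex.differentiableOn_tsum_of_summable_norm hs.norm (fun n => by fun_prop)
    Metric.isOpen_ball fun n w hw => ?_
  rw [norm_mul, norm_mul, norm_pow, norm_pow, Complex.norm_real]
  exact mul_le_mul_of_nonneg_left (pow_le_pow_left₀ (norm_nonneg _)
    ((mem_ball_zero_iff.1 hw).le.trans (le_abs_self _)) n) (norm_nonneg _)

theorem hasDerivAt_cpsEval {x : ℝ} (hx : |x| < R) :
    HasDerivAt (cpsEval p) (deriv (cpsEval p) x) x :=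
  ((differentiableOn_cpsEval hs).differentiableAt
    (Metric.isOpen_ball.mem_nhds (by simpa using hx))).hasDerivAt

theorem differentiableAt_psEval {x : ℝ} (hx : |x| < R) : DifferentiableAt ℝ (psEval p) x := by
  simpa only [cpsEval_ofReal, Complex.ofReal_re] using
    (hasDerivAt_cpsEval hs hx).real_of_complex.differentiableAt

theorem deriv_cpsEval_ofReal {x : ℝ} (hx : |x| < R) :
    deriv (cpsEval p) x = (deriv (psEval p) x : ℝ) := by
  have along_reals := (hasDerivAt_cpsEval hs hx).comp_ofReal
  simp only [cpsEval_ofReal] at along_reals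
  exact along_reals.unique (differentiableAt_psEval hs hx).hasDerivAt.ofReal_comp

variable (hR : 1 < R)
include hR

theorem dslope_cpsEval_one : dslope (cpsEval p) 1 1 = (deriv (psEval p) 1 : ℝ) := by
  rw [dslope_same, ← deriv_cpsEval_ofReal hs (by rwa [abs_one]), Complex.ofReal_one]

theorem differentiableOn_dslope_cpsEval :
    DifferentiableOn ℂ (dslope (cpsEval p) 1) (Metric.ball 0 R) :=
  (Complex.differentiableOn_dslope (Metric.isOpen_ball.mem_nhds (by simpa using hR))).2
    (differentiableOn_cpsEval hs)

end Differentiability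

theorem sum_coeff_one_sub_X_mul (s : PowerSeries ℝ) (n : ℕ) :
    ∑ i ∈ Finset.range (n + 1), coeff i ((1 - PowerSeries.X) * s) = coeff n s := by
  induction n with
  | zero => simp
  | succ n ih =>
    rw [Finset.sum_range_succ, ih, sub_mul, one_mul, map_sub, PowerSeries.coeff_succ_X_mul]
    ring

theorem hasSum_coeff_one_sub_X (x : ℝ) :
    HasSum (fun n => coeff n (1 - PowerSeries.X : PowerSeries ℝ) * x ^ n) (1 - x) := by
  have := hasSum_coeff_mul_pow (1 - Polynomial.X) x
  simpa [← Polynomial.coeff_coe] using this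

/- `F` equals its Taylor series on a disk containing `1`, and the real parts of the Taylor
coefficients are determined by the values on `(0, 1)`. -/
theorem hasSum_coeff_of_differentiableOn {F : ℂ → ℂ} {R : ℝ} (hR : 1 < R)
    (hF : DifferentiableOn ℂ F (Metric.ball 0 R)) {e : PowerSeries ℝ}
    (he : ∀ x ∈ Set.Ioo (0 : ℝ) 1, HasSum (fun n => coeff n e * x ^ n) (F x).re) :
    HasSum (fun n => coeff n e) (F 1).re := by
  set taylor : PowerSeries ℝ :=
    PowerSeries.mk fun n => ((n.factorial : ℂ)⁻¹ * iteratedDeriv n F 0).re with h_taylor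
  have hasSum_taylor {x : ℝ} (hx₀ : 0 ≤ x) (hx₁ : x ≤ 1) :
      HasSum (fun n => coeff n taylor * x ^ n) (F x).re := by
    have complex_sum := Complex.hasSum_taylorSeries_on_ball hF (z := (x : ℂ)) (by
      rw [mem_ball_zero_iff, Complex.norm_real, Real.norm_of_nonneg hx₀]
      exact hx₁.trans_lt hR)
    refine (Complex.hasSum_re complex_sum).congr_fun fun n => ?_
    rw [h_taylor, PowerSeries.coeff_mk, sub_zero, smul_eq_mul, smul_eq_mul,
      ← Complex.ofReal_pow, mul_left_comm, Complex.re_ofReal_mul, mul_comm]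
  rw [ext_of_forall_hasSum he fun x hx => hasSum_taylor hx.1.le hx.2.le]
  simpa using hasSum_taylor zero_le_one le_rfl

theorem exists_one_lt_forall_ball_ne_zero {G : ℂ → ℂ} {R : ℝ} (hR : 1 < R)
    (hG : ContinuousOn G (Metric.ball 0 R)) (hne : ∀ z, ‖z‖ ≤ 1 → G z ≠ 0) :
    ∃ r, 1 < r ∧ ∀ z ∈ Metric.ball (0 : ℂ) r, z ∈ Metric.ball (0 : ℂ) R ∧ G z ≠ 0 := by
  obtain ⟨δ, hδ, subset⟩ := (isCompact_closedBall (0 : ℂ) 1).exists_cthickening_subset_open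
    (hG.isOpen_inter_preimage Metric.isOpen_ball isOpen_compl_singleton)
    fun z hz => ⟨Metric.closedBall_subset_ball hR hz, hne z (mem_closedBall_zero_iff.1 hz)⟩
  rw [cthickening_closedBall hδ.le zero_le_one] at subset
  exact ⟨δ + 1, by linarith, fun z hz => subset (Metric.ball_subset_closedBall hz)⟩

theorem IsLongTailed.of_tendsto {c : ℕ → ℝ} {l : ℝ} (hl : 0 < l) (h : Tendsto c atTop (𝓝 l)) :
    IsLongTailed c where
  eventually_pos := h.eventually (lt_mem_nhds hl)
  tendsto_div_succ := by
    have ratio := h.div (h.comp (tendsto_add_atTop_nat 1)) hl.ne'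
    rwa [div_self hl.ne'] at ratio

namespace IsProbSeries

variable {p : PowerSeries ℝ} (hp : IsProbSeries p)
include hp

theorem psEval_one : psEval p 1 = 1 := by
  simpa [psEval] using hp.hasSum.tsum_eq

theorem one_le_deriv (h : DifferentiableAt ℝ (psEval p) 1) : 1 ≤ deriv (psEval p) 1 := by
  have slope_tendsto := (hasDerivAt_iff_tendsto_slope.1 h.hasDerivAt).mono_left
    (nhdsLT_le_nhdsNE (1 : ℝ))
  refine ge_of_tendsto slope_tendsto ?_
  filter_upwards [Ioo_mem_nhdsLT (zero_lt_one' ℝ)] with x hx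
  rw [slope_comm, slope_def_field, hp.psEval_one, le_div_iff₀ (sub_pos.2 hx.2)]
  linarith [(hp.psEval_mem_Icc hx.1.le hx.2).2]

theorem dslope_cpsEval_of_ne {z : ℂ} (hz : z ≠ 1) :
    dslope (cpsEval p) 1 z = (1 - cpsEval p z) / (1 - z) := by
  have cpsEval_one : cpsEval p 1 = 1 := by
    simpa only [Complex.ofReal_one, hp.psEval_one] using cpsEval_ofReal p 1
  rw [dslope_of_ne _ hz, slope_comm, slope_def_field, cpsEval_one]

variable {R : ℝ} (hR : 1 < R) (hs : Summable fun n => coeff n p * R ^ n)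
include hR hs

theorem one_le_deriv_of_summable : 1 ≤ deriv (psEval p) 1 :=
  hp.one_le_deriv (differentiableAt_psEval hs (by rwa [abs_one]))

variable (hne : ∀ z : ℂ, ‖z‖ ≤ 1 → z ≠ 1 → cpsEval p z ≠ 1)
include hne

theorem dslope_cpsEval_ne_zero {z : ℂ} (hz : ‖z‖ ≤ 1) : dslope (cpsEval p) 1 z ≠ 0 := by
  rcases eq_or_ne z 1 with rfl | z_ne_one
  · rw [dslope_cpsEval_one hs hR, Complex.ofReal_ne_zero]
    linarith [hp.one_le_deriv_of_summable hR hs]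
  · rw [hp.dslope_cpsEval_of_ne z_ne_one]
    exact div_ne_zero (sub_ne_zero.2 (hne z hz z_ne_one).symm) (sub_ne_zero.2 z_ne_one.symm)

/-- The renewal theorem with exponential tails: `(1 - z) / (1 - p z)` is the reciprocal of the
slope of `p` between `z` and `1`, which has no zero in a disk larger than the unit disk. -/
theorem tendsto_coeff_inv :
    Tendsto (fun n => coeff n (1 - p)⁻¹) atTop (𝓝 (deriv (psEval p) 1)⁻¹) := by
  obtain ⟨r, hr, ball_r⟩ := exists_one_lt_forall_ball_ne_zero hR
    (differentiableOn_dslope_cpsEval hs hR).continuousOn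
    fun z hz => hp.dslope_cpsEval_ne_zero hR hs hne hz
  have differentiable_inv : DifferentiableOn ℂ (fun z => (dslope (cpsEval p) 1 z)⁻¹)
      (Metric.ball 0 r) :=
    ((differentiableOn_dslope_cpsEval hs hR).mono fun z hz => (ball_r z hz).1).inv
      fun z hz => (ball_r z hz).2
  have hasSum_increments := hasSum_coeff_of_differentiableOn hr differentiable_inv
    (e := (1 - PowerSeries.X) * (1 - p)⁻¹) fun x hx => by
      have x_ne_one : (x : ℂ) ≠ 1 := by exact_mod_cast hx.2.ne
      have value : (dslope (cpsEval p) 1 x)⁻¹ =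
          (((1 - x) * (1 - psEval p x)⁻¹ : ℝ) : ℂ) := by
        rw [hp.dslope_cpsEval_of_ne x_ne_one, inv_div, cpsEval_ofReal]
        push_cast
        exact div_eq_mul_inv _ _
      rw [value, Complex.ofReal_re]
      exact hasSum_coeff_mul (hasSum_coeff_one_sub_X x)
        (hp.hasSum_inv (abs_lt.2 ⟨by linarith [hx.1], hx.2⟩))
  rw [dslope_cpsEval_one hs hR, ← Complex.ofReal_inv, Complex.ofReal_re] at hasSum_increments
  exact (hasSum_increments.tendsto_sum_nat.comp (tendsto_add_atTop_nat 1)).congr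
    fun n => sum_coeff_one_sub_X_mul _ n

end IsProbSeries

end Renewal

section Normalization

theorem IsRightInverse.normalize {q c : ℝ} {φ g : PowerSeries ℝ} (hc : c ≠ 0)
    (h : IsRightInverse q (PowerSeries.X * (1 - φ)) g) :
    IsRightInverse q (PowerSeries.X * (1 - rescale c φ)) (PowerSeries.C c⁻¹ * rescale c g) := by
  convert h.conj hc using 1
  rw [map_mul, PowerSeries.rescale_X, map_sub, map_one, ← mul_assoc, ← mul_assoc, ← map_mul,
    inv_mul_cancel₀ hc, map_one, one_mul]

theorem constantCoeff_rescale_eq_zero {φ : PowerSeries ℝ} (hφ : constantCoeff φ = 0) (c : ℝ) :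
    constantCoeff (rescale c φ) = 0 := by
  rw [← PowerSeries.coeff_zero_eq_constantCoeff_apply, PowerSeries.coeff_rescale, pow_zero,
    one_mul, PowerSeries.coeff_zero_eq_constantCoeff_apply, hφ]

theorem isProbSeries_rescale {φ : PowerSeries ℝ} {ζ : ℝ} (hφ₀ : constantCoeff φ = 0)
    (hφ : ∀ n, 0 ≤ coeff n φ) (hζ : 0 < ζ) (h : HasSum (fun n => coeff n φ * ζ ^ n) 1) :
    IsProbSeries (rescale ζ φ) where
  constantCoeff_eq := constantCoeff_rescale_eq_zero hφ₀ ζ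
  nonneg n := by
    rw [PowerSeries.coeff_rescale]
    exact mul_nonneg (pow_nonneg hζ.le n) (hφ n)
  hasSum := by
    simpa only [PowerSeries.coeff_rescale, mul_comm] using h

theorem IsProbSeries.coeff_rightInverse_nonneg {p : PowerSeries ℝ} (hp : IsProbSeries p)
    {g : ℝ → PowerSeries ℝ}
    (hg : ∀ q ∈ Set.Ioo (0 : ℝ) 1, IsRightInverse q (PowerSeries.X * (1 - p)) (g q)) {q : ℝ}
    (hq : q ∈ Set.Ioo (0 : ℝ) 1) (n : ℕ) : 0 ≤ coeff n (g q) :=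
  nonneg_of_mul_nonneg_right (nonneg_of_mem_nonnegPolynomialFunctions
    (coeff_mem_nonnegPolynomialFunctions hp.constantCoeff_eq hp.nonneg hg n) ⟨q, hq⟩)
    (pow_pos hq.1 _)

end Normalization

section RegVar

namespace IsProbSeries

variable {p : PowerSeries ℝ} {ρ : ℝ} (hp : IsProbSeries p)
include hp

theorem mul_one_sub_psEval_nonneg (n : ℕ) : 0 ≤ n * (1 - psEval p (1 - 1 / (n : ℝ))) := by
  rcases n.eq_zero_or_pos with rfl | hn
  · simp
  · have lt_one : 1 - 1 / (n : ℝ) < 1 := sub_lt_self _ (by positivity)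
    have le := (hp.psEval_mem_Icc (one_sub_one_div_natCast_nonneg n) lt_one).2
    exact mul_nonneg n.cast_nonneg (by linarith)

variable (hρ : ρ - 1 ∈ Set.Ioc (-1 : ℝ) 0)
  (hc : RegularlyVaryingSeq (fun n => coeff n (1 - p)⁻¹) (ρ - 1))
include hρ hc

theorem tendsto_mul_one_sub_psEval_mul_coeff_inv :
    Tendsto (fun n : ℕ => n * (1 - psEval p (1 - 1 / (n : ℝ))) * coeff n (1 - p)⁻¹) atTop
      (𝓝 (Real.Gamma ρ)⁻¹) := by
  have Gamma_ne_zero : Real.Gamma ρ ≠ 0 := (Real.Gamma_pos_of_pos (by linarith [hρ.1])).ne'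
  have abelian := (hc.tendsto_tsum_div hρ fun n => (hp.coeff_inv_mem_Icc n).1).inv₀ Gamma_ne_zero
  refine abelian.congr' ?_
  filter_upwards [eventually_ge_atTop 1] with n hn
  have lt_one : |1 - 1 / (n : ℝ)| < 1 := by
    rw [abs_of_nonneg (one_sub_one_div_natCast_nonneg n)]
    exact sub_lt_self _ (by positivity)
  rw [(hp.hasSum_inv lt_one).tsum_eq, inv_div, div_inv_eq_mul]
  ring

theorem tendsto_rightInverse_of_regVar {q : ℝ} (hq : q ∈ Set.Ioo (0 : ℝ) 1) {g : PowerSeries ℝ}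
    (h : IsRightInverse q (PowerSeries.X * (1 - p)) g) (hg : ∀ n, 0 ≤ coeff n g) :
    Tendsto (fun n : ℕ => n * (1 - psEval p (1 - 1 / (n : ℝ))) * (q ^ n.choose 2 * coeff n g))
      atTop (𝓝 (Real.Gamma ρ * ∏' j : ℕ, (1 - psEval p (q ^ (j + 1))))⁻¹) := by
  have longTailed := hc.isLongTailed fun n => (hp.coeff_inv_mem_Icc n).1
  have product := (((tendsto_add_atTop_iff_nat 1).2
    (hp.tendsto_mul_one_sub_psEval_mul_coeff_inv hρ hc)).mul longTailed.tendsto_div_succ).mul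
      (h.tendsto_div hp hq hg longTailed)
  rw [mul_one, ← mul_inv] at product
  rw [← tendsto_add_atTop_iff_nat 1]
  refine product.congr' ?_
  filter_upwards [longTailed.eventually_pos,
    (tendsto_add_atTop_nat 1).eventually longTailed.eventually_pos] with n hn hn'
  field_simp

end IsProbSeries

/-- The strengthening of `RegVarConclusion` in which the convergence in limit infimum and the
convergence off a set of density zero are replaced by pointwise convergence on `(0, 1)`. -/
def PointwiseRegVarConclusion (φ : PowerSeries ℝ) (ζ ρ : ℝ) (γ : ℝ → ℕ → ℝ) : Prop :=
  ∃ (a : ℕ → Polynomial ℝ) (L : PowerSeries ℝ),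
    (∀ n, ∀ q ∈ Set.Ioo (0 : ℝ) 1,
      (a n).eval q =
        ζ ^ n * n * (1 - psEval φ (ζ * (1 - 1 / (n : ℝ)))) * q ^ n.choose 2 * γ q n) ∧
    (∀ q ∈ Set.Ioo (0 : ℝ) 1,
      Multipliable (fun j : ℕ => 1 - psEval φ (ζ * q ^ (j + 1))) ∧
      HasSum (fun j : ℕ => coeff j L * q ^ j)
        (ζ / (Real.Gamma ρ * ∏' j : ℕ, (1 - psEval φ (ζ * q ^ (j + 1)))))) ∧
    (∀ q ∈ Set.Ioo (0 : ℝ) 1, Tendsto (fun n => (a n).eval q) atTop (𝓝 (psEval L q))) ∧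
    ConvergesCoeffwise a L

theorem PointwiseRegVarConclusion.regVarConclusion {φ : PowerSeries ℝ} {ζ ρ : ℝ}
    {γ : ℝ → ℕ → ℝ} (h : PointwiseRegVarConclusion φ ζ ρ γ) : RegVarConclusion φ ζ ρ γ := by
  obtain ⟨a, L, eval_eq, hL, pointwise, coeffwise⟩ := h
  exact ⟨a, L, fun n _ => eval_eq n, hL, convergesLiminf_of_tendsto pointwise,
    convergesOffDensityZero_of_tendsto pointwise, coeffwise⟩

theorem pointwiseRegVarConclusion {φ : PowerSeries ℝ} {ζ ρ : ℝ} (hζ : 0 < ζ)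
    (hp : IsProbSeries (rescale ζ φ)) (hρ : ρ - 1 ∈ Set.Ioc (-1 : ℝ) 0)
    (hc : RegularlyVaryingSeq (fun n => coeff n (1 - rescale ζ φ)⁻¹) (ρ - 1))
    {g : ℝ → PowerSeries ℝ}
    (hg : ∀ q ∈ Set.Ioo (0 : ℝ) 1, IsRightInverse q (PowerSeries.X * (1 - φ)) (g q)) :
    PointwiseRegVarConclusion φ ζ ρ fun q n => coeff n (g q) := by
  have normalized (q : ℝ) (hq : q ∈ Set.Ioo (0 : ℝ) 1) := (hg q hq).normalize hζ.ne'
  have mem (n : ℕ) := mul_mem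
    (const_mem_nonnegPolynomialFunctions (mul_nonneg hζ.le (hp.mul_one_sub_psEval_nonneg n)))
    (coeff_mem_nonnegPolynomialFunctions hp.constantCoeff_eq hp.nonneg normalized n)
  choose a coeff_nonneg eval_eq using fun n => exists_polynomial_of_mem (mem n)
  have limit (q : ℝ) (hq : q ∈ Set.Ioo (0 : ℝ) 1) : Tendsto (fun n => (a n).eval q) atTop
      (𝓝 (ζ / (Real.Gamma ρ * ∏' j : ℕ, (1 - psEval φ (ζ * q ^ (j + 1)))))) := by
    have scaled := (hp.tendsto_rightInverse_of_regVar hρ hc hq (normalized q hq)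
      (hp.coeff_rightInverse_nonneg normalized hq)).const_mul ζ
    simp only [psEval_rescale, ← div_eq_mul_inv, ← mul_assoc] at scaled
    refine scaled.congr fun n => ?_
    rw [eval_eq n ⟨q, hq⟩, Pi.mul_apply, psEval_rescale]
    ring
  obtain ⟨L, hL, coeff_tendsto⟩ := exists_powerSeries_of_tendsto_eval coeff_nonneg limit
  refine ⟨a, L, fun n q hq => ?_, fun q hq => ⟨?_, hL q hq⟩, fun q hq => ?_, coeff_tendsto⟩
  · rw [eval_eq n ⟨q, hq⟩, Pi.mul_apply, psEval_rescale, PowerSeries.coeff_C_mul,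
      PowerSeries.coeff_rescale]
    field_simp
  · simpa only [psEval_rescale] using hp.multipliable_one_sub_psEval hq
  · rw [psEval, (hL q hq).tsum_eq]
    exact limit q hq

theorem RegVarAssumptions.isProbSeries {φ : PowerSeries ℝ} {ζ ρ : ℝ}
    (h : RegVarAssumptions φ ζ ρ) (hφ : constantCoeff φ = 0) : IsProbSeries (rescale ζ φ) := by
  refine isProbSeries_rescale hφ (fun n => ?_) h.zeta_isLeast.1.1 h.zeta_isLeast.1.2
  rcases n.eq_zero_or_pos with rfl | hn
  · rw [PowerSeries.coeff_zero_eq_constantCoeff_apply, hφ]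
  · exact h.nonneg n hn

end RegVar

section DominantRoot

/-- The assumptions that `ζ` is the only solution of `φ(z) = 1` in the disk `|z| ≤ ζ`, with
`φ(z) = 1 - (1 - z/ζ) θ(z)` there, and that `φ`, with nonnegative coefficients, converges beyond
`ζ`. -/
structure DominantRootAssumptions (φ : PowerSeries ℝ) (ζ : ℝ) (θ : ℂ → ℂ) : Prop where
  nonneg : ∀ n, 0 ≤ coeff n φ
  zeta_pos : 0 < ζ
  summable : ∃ R, ζ < R ∧ Summable fun n => coeff n φ * R ^ n
  factor : ∀ z : ℂ, ‖z‖ ≤ ζ → cpsEval φ z = 1 - (1 - z / ζ) * θ z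
  no_root : ∀ z : ℂ, ‖z‖ ≤ ζ → z ≠ ζ → θ z ≠ 0

theorem SuperexpAssumptions.dominantRootAssumptions {φ : PowerSeries ℝ} {ζ : ℝ} {θ : ℂ → ℂ}
    (h : SuperexpAssumptions φ ζ θ) : DominantRootAssumptions φ ζ θ where
  nonneg := h.nonneg
  zeta_pos := h.zeta_pos
  summable := by
    refine ⟨ζ + 1, lt_add_one ζ, Complex.summable_ofReal.1 ?_⟩
    simpa only [Complex.ofReal_mul, Complex.ofReal_pow] using
      (h.factor ((ζ + 1 : ℝ) : ℂ)).summable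
  factor z _ := (h.factor z).tsum_eq
  no_root z hz _ := h.no_root z hz

theorem cpsEval_rescale (a : ℝ) (p : PowerSeries ℝ) (z : ℂ) :
    cpsEval (rescale a p) z = cpsEval p (a * z) := by
  simp only [cpsEval, PowerSeries.coeff_rescale, mul_pow, Complex.ofReal_mul, Complex.ofReal_pow]
  exact tsum_congr fun n => by ring

theorem deriv_psEval_rescale (a : ℝ) (p : PowerSeries ℝ) (x : ℝ) :
    deriv (psEval (rescale a p)) x = a * deriv (psEval p) (a * x) := by
  rw [← smul_eq_mul, ← deriv_comp_mul_left]
  exact congrArg (deriv · x) (funext (psEval_rescale a p))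

theorem isProbSeries_X : IsProbSeries PowerSeries.X where
  constantCoeff_eq := PowerSeries.constantCoeff_X
  nonneg n := by
    rw [PowerSeries.coeff_X]
    split_ifs <;> simp
  hasSum := by
    simpa only [PowerSeries.coeff_X] using hasSum_ite_eq 1 (1 : ℝ)

theorem psEval_X (x : ℝ) : psEval PowerSeries.X x = x := by
  simp [psEval, PowerSeries.coeff_X]

namespace DominantRootAssumptions

variable {φ : PowerSeries ℝ} {ζ : ℝ} {θ : ℂ → ℂ} (h : DominantRootAssumptions φ ζ θ)
include h

theorem summable_rescale : ∃ R, 1 < R ∧ Summable fun n => coeff n (rescale ζ φ) * R ^ n := by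
  obtain ⟨R, zeta_lt, summable⟩ := h.summable
  refine ⟨R / ζ, (one_lt_div h.zeta_pos).2 zeta_lt, summable.congr fun n => ?_⟩
  have hζ := h.zeta_pos
  rw [PowerSeries.coeff_rescale, div_pow]
  field_simp

theorem cpsEval_rescale_eq {z : ℂ} (hz : ‖z‖ ≤ 1) :
    cpsEval (rescale ζ φ) z = 1 - (1 - z) * θ (ζ * z) := by
  rw [cpsEval_rescale, h.factor, mul_div_cancel_left₀ _ (Complex.ofReal_ne_zero.2 h.zeta_pos.ne')]
  rw [norm_mul, Complex.norm_real, Real.norm_of_nonneg h.zeta_pos.le]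
  exact mul_le_of_le_one_right h.zeta_pos.le hz

theorem cpsEval_rescale_ne_one {z : ℂ} (hz : ‖z‖ ≤ 1) (hz' : z ≠ 1) :
    cpsEval (rescale ζ φ) z ≠ 1 := by
  rw [h.cpsEval_rescale_eq hz, Ne, sub_eq_self]
  refine mul_ne_zero (sub_ne_zero.2 hz'.symm) (h.no_root _ ?_ ?_)
  · rw [norm_mul, Complex.norm_real, Real.norm_of_nonneg h.zeta_pos.le]
    exact mul_le_of_le_one_right h.zeta_pos.le hz
  · rwa [Ne, mul_eq_left₀ (Complex.ofReal_ne_zero.2 h.zeta_pos.ne')]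

theorem isProbSeries (hφ : constantCoeff φ = 0) : IsProbSeries (rescale ζ φ) := by
  have root : psEval φ ζ = 1 := by
    have at_one := h.cpsEval_rescale_eq (z := 1) (by simp)
    rw [sub_self, zero_mul, sub_zero, cpsEval_rescale, mul_one, cpsEval_ofReal] at at_one
    exact_mod_cast at_one
  obtain ⟨R, zeta_lt, summable⟩ := h.summable
  have summable_zeta : Summable fun n => coeff n φ * ζ ^ n := by
    refine summable.of_nonneg_of_le (fun n => ?_) (fun n => ?_)
    · exact mul_nonneg (h.nonneg n) (pow_nonneg h.zeta_pos.le n)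
    · exact mul_le_mul_of_nonneg_left (pow_le_pow_left₀ h.zeta_pos.le zeta_lt.le n) (h.nonneg n)
  exact isProbSeries_rescale hφ h.nonneg h.zeta_pos (root ▸ summable_zeta.hasSum)

theorem theta_mul_ofReal {x : ℝ} (hx : x ∈ Set.Ioo (0 : ℝ) 1) :
    θ ((ζ * x : ℝ) : ℂ) = ((1 - psEval (rescale ζ φ) x) / (1 - x) : ℝ) := by
  have factored := h.cpsEval_rescale_eq (z := x)
    (by rw [Complex.norm_real, Real.norm_of_nonneg hx.1.le]; exact hx.2.le)
  have ne_zero : (1 - x : ℂ) ≠ 0 := by exact_mod_cast (sub_pos.2 hx.2).ne'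
  rw [cpsEval_ofReal] at factored
  push_cast
  rw [factored, sub_sub_cancel, mul_div_cancel_left₀ _ ne_zero]

variable (hφ : constantCoeff φ = 0) {q : ℝ} (hq : q ∈ Set.Ioo (0 : ℝ) 1)
include hφ hq

theorem hasProd_theta : HasProd (fun j : ℕ => θ ((ζ * q ^ (j + 1) : ℝ) : ℂ))
    (((∏' j : ℕ, (1 - psEval (rescale ζ φ) (q ^ (j + 1)))) / ∏' j : ℕ, (1 - q ^ (j + 1)) : ℝ) :
      ℂ) := by
  have numerator := ((h.isProbSeries hφ).multipliable_one_sub_psEval hq).hasProd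
  have denominator := (isProbSeries_X.multipliable_one_sub_psEval hq).hasProd
  have denominator_ne_zero := isProbSeries_X.tprod_one_sub_psEval_ne_zero hq
  simp only [psEval_X] at denominator denominator_ne_zero
  have quotient := (numerator.div₀ denominator denominator_ne_zero).map Complex.ofRealHom
    Complex.continuous_ofReal
  refine quotient.congr_fun fun j => ?_
  exact h.theta_mul_ofReal ⟨pow_pos hq.1 _, pow_lt_one₀ hq.1.le hq.2 j.succ_ne_zero⟩

theorem tendsto_rightInverse {g : PowerSeries ℝ}
    (hg : IsRightInverse q (PowerSeries.X * (1 - rescale ζ φ)) g) (hg₀ : ∀ n, 0 ≤ coeff n g) :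
    Tendsto (fun n : ℕ => q ^ n.choose 2 * coeff n g) atTop
      (𝓝 ((∏' j : ℕ, (1 - psEval (rescale ζ φ) (q ^ (j + 1))))⁻¹ *
        (deriv (psEval (rescale ζ φ)) 1)⁻¹)) := by
  have hp := h.isProbSeries hφ
  obtain ⟨R, hR, summable⟩ := h.summable_rescale
  have renewal := hp.tendsto_coeff_inv hR summable fun z => h.cpsEval_rescale_ne_one
  have longTailed := IsLongTailed.of_tendsto
    (inv_pos.2 (one_pos.trans_le (hp.one_le_deriv_of_summable hR summable))) renewal
  rw [← tendsto_add_atTop_iff_nat 1]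
  refine ((hg.tendsto_div hp hq hg₀ longTailed).mul renewal).congr' ?_
  filter_upwards [longTailed.eventually_pos] with n hn
  exact div_mul_cancel₀ _ hn.ne'

end DominantRootAssumptions

theorem DominantRootAssumptions.superexpConclusion {φ : PowerSeries ℝ} {ζ : ℝ} {θ : ℂ → ℂ}
    (h : DominantRootAssumptions φ ζ θ) (hφ : constantCoeff φ = 0) {g : ℝ → PowerSeries ℝ}
    (hg : ∀ q ∈ Set.Ioo (0 : ℝ) 1, IsRightInverse q (PowerSeries.X * (1 - φ)) (g q)) {q : ℝ}
    (hq : q ∈ Set.Ioo (0 : ℝ) 1) : SuperexpConclusion φ ζ θ q fun n => coeff n (g q) := by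
  have hζ := h.zeta_pos
  have hp := h.isProbSeries hφ
  have normalized (q : ℝ) (hq : q ∈ Set.Ioo (0 : ℝ) 1) := (hg q hq).normalize hζ.ne'
  have limit := h.tendsto_rightInverse hφ hq (normalized q hq)
    (hp.coeff_rightInverse_nonneg normalized hq)
  obtain ⟨R, hR, summable⟩ := h.summable_rescale
  have deriv_pos := one_pos.trans_le (hp.one_le_deriv_of_summable hR summable)
  have tprod_ne_zero := hp.tprod_one_sub_psEval_ne_zero hq
  have tprod_X_ne_zero := isProbSeries_X.tprod_one_sub_psEval_ne_zero hq
  have hθ := h.hasProd_theta hφ hq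
  refine ⟨by simpa only [psEval_X] using isProbSeries_X.multipliable_one_sub_psEval hq,
    hθ.multipliable, isEquivalent_of_tendsto_one ?_⟩
  rw [hθ.tprod_eq]
  have ratio := limit.mul_const
    ((∏' j : ℕ, (1 - psEval (rescale ζ φ) (q ^ (j + 1)))) * deriv (psEval (rescale ζ φ)) 1)
  rw [← mul_inv, inv_mul_cancel₀ (mul_ne_zero tprod_ne_zero deriv_pos.ne')] at ratio
  have ratio_complex := (Complex.continuous_ofReal.tendsto 1).comp ratio
  rw [Complex.ofReal_one] at ratio_complex
  refine ratio_complex.congr fun n => ?_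
  simp only [psEval_X] at tprod_X_ne_zero
  simp only [Function.comp, Pi.div_apply, deriv_psEval_rescale, mul_one, PowerSeries.coeff_C_mul,
    PowerSeries.coeff_rescale]
  rw [div_div_eq_mul_div, div_one, ← Complex.ofReal_mul, ← Complex.ofReal_mul, Complex.ofReal_inj]
  field_simp

end DominantRoot

end QLagrange

open QLagrange in
theorem theorem2p7_general (φ : PowerSeries ℝ) (hφ : constantCoeff φ = 0) (g : ℝ → PowerSeries ℝ)
    (hg : ∀ q ∈ Set.Ioo (0 : ℝ) 1, IsRightInverse q (PowerSeries.X * (1 - φ)) (g q)) :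
    (∀ ζ ρ : ℝ, 0 < ζ → IsProbSeries (rescale ζ (rescale (-1 : ℝ) φ)) →
      ρ - 1 ∈ Set.Ioc (-1 : ℝ) 0 →
      RegularlyVaryingSeq (fun n => coeff n (1 - rescale ζ (rescale (-1 : ℝ) φ))⁻¹) (ρ - 1) →
      PointwiseRegVarConclusion (rescale (-1 : ℝ) φ) ζ ρ
        (fun q n => (-1) ^ (n + 1) * coeff n (g q))) ∧
    (∀ (ζ : ℝ) (θ : ℂ → ℂ), DominantRootAssumptions (rescale (-1 : ℝ) φ) ζ θ →
      ∀ q ∈ Set.Ioo (0 : ℝ) 1,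
        SuperexpConclusion (rescale (-1 : ℝ) φ) ζ θ q
          (fun n => (-1) ^ (n + 1) * coeff n (g q))) := by
  have normalized (q : ℝ) (hq : q ∈ Set.Ioo (0 : ℝ) 1) :=
    (hg q hq).normalize (neg_ne_zero.2 one_ne_zero)
  have coeff_eq (q : ℝ) (n : ℕ) : (-1) ^ (n + 1) * coeff n (g q) =
      coeff n (PowerSeries.C (-1 : ℝ)⁻¹ * rescale (-1 : ℝ) (g q)) := by
    rw [PowerSeries.coeff_C_mul, PowerSeries.coeff_rescale, inv_neg_one, pow_succ']
    ring
  simp only [coeff_eq]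
  exact ⟨fun ζ ρ hζ hp hρ hc => pointwiseRegVarConclusion hζ hp hρ hc normalized,
    fun ζ θ h q hq => h.superexpConclusion (constantCoeff_rescale_eq_zero hφ _) normalized hq⟩

/-- `φ` has no constant term, `f(z) = z (1 - φ(z))`, and for `0 < q < 1` the series `g q` is the
right inverse of `f`. The series `rescale (-1) φ` is `φ(-z)`. -/
theorem theorem2p7 (φ : PowerSeries ℝ) (hφ : constantCoeff φ = 0)
    (g : ℝ → PowerSeries ℝ)
    (hg : ∀ q ∈ Set.Ioo (0 : ℝ) 1,
      QLagrange.IsRightInverse q (PowerSeries.X * (1 - φ)) (g q)) :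
    (∀ ζ ρ : ℝ, QLagrange.RegVarAssumptions (rescale (-1 : ℝ) φ) ζ ρ →
      QLagrange.RegVarConclusion (rescale (-1 : ℝ) φ) ζ ρ
        (fun q n => (-1) ^ (n + 1) * coeff n (g q))) ∧
    (∀ (ζ : ℝ) (θ : ℂ → ℂ), QLagrange.SuperexpAssumptions (rescale (-1 : ℝ) φ) ζ θ →
      ∀ q ∈ Set.Ioo (0 : ℝ) 1,
        QLagrange.SuperexpConclusion (rescale (-1 : ℝ) φ) ζ θ q
          (fun n => (-1) ^ (n + 1) * coeff n (g q))) := by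
  obtain ⟨regVar, dominantRoot⟩ := theorem2p7_general φ hφ g hg
  exact ⟨fun ζ ρ h => (regVar ζ ρ h.zeta_isLeast.1.1
      (h.isProbSeries (QLagrange.constantCoeff_rescale_eq_zero hφ _)) h.rho_mem
      h.regVar).regVarConclusion,
    fun ζ θ h => dominantRoot ζ θ h.dominantRootAssumptions⟩
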